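/- Let $n\ge 2$, let $\lambda,\mu\in\mathbb R$ satisfy $\mu>0$ and $\lambda+2\mu>0$, and let $L^{1,1}(\mathbb R^n)=\{f:(1+|x|)f\in L^1(\mathbb R^n;\mathbb R)\}$ with $\|f\|_{L^{1,1}}=\|(1+|x|)f\|_{L^1}$. Let $f_0=(f_{01},\dots,f_{0n})\in\{H^1\cap L^{1,1}\}^n$ and $f_1=(f_{11},\dots,f_{1n})\in\{L^2\cap L^{1,1}\}^n$ be real-valued, and let $u=(u_1,\dots,u_n)\in C([0,\infty);H^1)\cap C^1([0,\infty);L^2)$ be the (distributional) solution of $$\partial_t^2u-\mu\Delta u-(\lambda+\mu)\nabla(\operatorname{div}u)=0\quad (t>0,\ x\in\mathbb R^n),\qquad u(0)=f_0,\quad \partial_tu(0)=f_1 .$$ For $j\in\{0,1\}$ and $k,\ell\in\{1,\dots,n\}$ put $m_{jk}=\int f_{jk}\,dx$, $p_{jk,\ell}=-\int x_\ell f_{jk}\,dx$, $|M_j|=\sum_k|m_{jk}|$, $|P_{jk}|=\sum_\ell|p_{jk,\ell}|$ and, for $N\in\{1,\dots,n\}$, $$|\mathbb P_{j,N}|=|P_{jN}|+\sum_{k}|p_{jk,N}|+\sum_{k}|p_{jk,k}|+\sum_{\substack{k<\ell\\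 k\ne N,\ \ell\ne N}}|p_{jk,\ell}+p_{j\ell,k}| .$$ Write $\|f_j\|_2=\sum_k\|f_{jk}\|_{L^2}$ and $\|f_j\|_{1,1}=\sum_k\|f_{jk}\|_{L^{1,1}}$. Fix $N\in\{1,\dots,n\}$. **Upper bound, $n=2$.** There is a constant $C>0$ depending only on $\lambda,\mu$ such that for all such data and all $t\ge0$ $$\|u_N(t)\|_{L^2}\le C\big(\|f_0\|_2+|M_1|\sqrt{\log(t+2)}+\|f_1\|_{1,1}+\|f_1\|_2\big).$$ Moreover, for all such data there is a constant $C>0$, depending on $\lambda,\mu$ and on the data, such that for all $t\ge 0$ $$\|u_N(t)\|_{L^2}\le C\big(\|f_0\|_2+|M_1|\sqrt{\log(t+2)}+\|f_1\|_{1,1}\big).$$ **Lower bounds.** Suppose in addition that $\lambda+\mu\ne0$. The constants $C>0$ and $T>0$ below may depend on $n,\lambda,\mu,N$ and on the data. (i) If $n=2$ and $\sum_{j=0}^1\sum_{k=1}^2|P_{jk}|\neq0$, then there are $C>0$ and $T>0$ such that for all $t\ge T$ $$\|u_N(t)\|_{L^2}\ge C\Big(|M_0|+|M_1|\sqrt{\log(t+2)}+\sum_{j=0}^1\sum_{k=1}^2|P_{jk}|\Big).$$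 (ii) If $n\ge3$ and $|\mathbb P_{0,N}|\ne0$ or $|\mathbb P_{1,N}|\neq0$, then there are $C>0$ and $T>0$ such that for all $t\ge T$ $$\|u_N(t)\|_{L^2}\ge C\big(|M_0|+|M_1|+|\mathbb P_{0,N}|+|\mathbb P_{1,N}|\big).$$ -/

import Mathlib

open MeasureTheory Set
open scoped SchwartzMap LineDeriv Laplacian

namespace ElasticWave

noncomputable section

/-- Euclidean space `ℝⁿ`. -/
abbrev E (n : ℕ) : Type := EuclideanSpace ℝ (Fin n)

/-- The real Hilbert space `L²(ℝⁿ; ℝ)`. -/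
abbrev L2 (n : ℕ) : Type := Lp ℝ 2 (volume : Measure (E n))

/-- The `i`-th unit vector of `ℝⁿ`. -/
def unitVec {n : ℕ} (i : Fin n) : E n := EuclideanSpace.single i 1

/-- The tempered distribution `φ ↦ ∫ φ f` given by a real function `f ∈ L²`. -/
def toDistr {n : ℕ} (f : L2 n) : 𝓢'(E n, ℂ) :=
  Lp.toTemperedDistribution (Complex.ofRealCLM.compLp f)

/-- `f` belongs to the Sobolev space `H¹(ℝⁿ)`. -/
def MemH1 {n : ℕ} (f : L2 n) : Prop :=
  TemperedDistribution.MemSobolev 1 2 (toDistr f)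

/-- `f` belongs to the weighted space `L^{1,1}(ℝⁿ)`, that is, `(1 + |x|) f ∈ L¹`. -/
def MemL11 {n : ℕ} (f : L2 n) : Prop :=
  Integrable (fun x : E n => (1 + ‖x‖) * f x)

/-- The initial data satisfy `f₀ ∈ (H¹ ∩ L^{1,1})ⁿ` and `f₁ ∈ (L² ∩ L^{1,1})ⁿ`. -/
structure IsData {n : ℕ} (f₀ f₁ : Fin n → L2 n) : Prop where
  memH1 : ∀ k, MemH1 (f₀ k)
  memL11_zero : ∀ k, MemL11 (f₀ k)
  memL11_one : ∀ k, MemL11 (f₁ k)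

/-- The time derivative `∂ₜ u_k(t)` in `L²`, for `t ∈ [0, ∞)` (one-sided at `t = 0`). -/
def timeDeriv {n : ℕ} (u : ℝ → Fin n → L2 n) (t : ℝ) (k : Fin n) : L2 n :=
  derivWithin (fun s => u s k) (Ici 0) t

/-- The distributional divergence of a vector field with `L²` components. -/
def divergence {n : ℕ} (w : Fin n → L2 n) : 𝓢'(E n, ℂ) :=
  ∑ j, ∂_{unitVec j} (toDistr (w j))

/-- The `k`-th component of `μ Δ w + (λ + μ) ∇ (div w)`, in the sense of distributions. -/
def lame {n : ℕ} (lam mu : ℝ) (w : Fin n → L2 n) (k : Fin n) : 𝓢'(E n, ℂ) :=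
  (mu : ℂ) • Δ (toDistr (w k)) + ((lam + mu : ℝ) : ℂ) • ∂_{unitVec k} (divergence w)

/-- `u` is the solution, in the class `C([0,∞); H¹) ∩ C¹([0,∞); L²)`, of the Cauchy problem
`∂ₜ² u - μ Δ u - (λ + μ) ∇ (div u) = 0`, `u(0) = f₀`, `∂ₜ u(0) = f₁`; the equation holds in the
sense of distributions on `ℝⁿ` at every time `t > 0`. The values of `u` at negative times play no
role. -/
structure IsSolution {n : ℕ} (lam mu : ℝ) (f₀ f₁ : Fin n → L2 n) (u : ℝ → Fin n → L2 n) :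
    Prop where
  /-- `u ∈ C¹([0,∞); L²)` -/
  contDiffOn : ∀ k, ContDiffOn ℝ 1 (fun t => u t k) (Ici 0)
  /-- `u ∈ C([0,∞); H¹)`: all first order weak derivatives of `u(t)` are in `L²` and depend
  continuously on `t` -/
  continuousOn_grad : ∀ k i, ∃ g : ℝ → L2 n, ContinuousOn g (Ici 0) ∧
    ∀ t, 0 ≤ t → ∂_{(unitVec i : E n)} (toDistr (u t k)) = toDistr (g t)
  /-- `∂ₜ² u = μ Δ u + (λ + μ) ∇ (div u)` -/
  equation : ∀ (k : Fin n) (φ : 𝓢(E n, ℂ)) (t : ℝ), 0 < t →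
    HasDerivAt (fun s => toDistr (timeDeriv u s k) φ) (lame lam mu (u t) k φ) t
  initial_zero : ∀ k, u 0 k = f₀ k
  initial_one : ∀ k, timeDeriv u 0 k = f₁ k

/-- `‖f‖₂ = ∑ₖ ‖f_k‖_{L²}`. -/
def norm2 {n : ℕ} (f : Fin n → L2 n) : ℝ := ∑ k, ‖f k‖

/-- `‖f‖_{1,1} = ∑ₖ ‖(1 + |x|) f_k‖_{L¹}`. -/
def norm11 {n : ℕ} (f : Fin n → L2 n) : ℝ := ∑ k, ∫ x : E n, (1 + ‖x‖) * |f k x|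

/-- The zeroth moment `m_k = ∫ f_k`. -/
def moment0 {n : ℕ} (f : Fin n → L2 n) (k : Fin n) : ℝ := ∫ x : E n, f k x

/-- The first moment `p_{k,ℓ} = -∫ x_ℓ f_k`. -/
def moment1 {n : ℕ} (f : Fin n → L2 n) (k l : Fin n) : ℝ := -∫ x : E n, x l * f k x

/-- `|M| = ∑ₖ |m_k|`. -/
def absM {n : ℕ} (f : Fin n → L2 n) : ℝ := ∑ k, |moment0 f k|

/-- `|P_k| = ∑_ℓ |p_{k,ℓ}|`. -/
def absP {n : ℕ} (f : Fin n → L2 n) (k : Fin n) : ℝ := ∑ l, |moment1 f k l|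

/-- `|ℙ_N| = |P_N| + ∑ₖ |p_{k,N}| + ∑ₖ |p_{k,k}| + ∑_{k < ℓ; k, ℓ ≠ N} |p_{k,ℓ} + p_{ℓ,k}|`. -/
def absPP {n : ℕ} (f : Fin n → L2 n) (N : Fin n) : ℝ :=
  absP f N + ∑ k, |moment1 f k N| + ∑ k, |moment1 f k k|
    + ∑ k, ∑ l, if k < l ∧ k ≠ N ∧ l ≠ N then |moment1 f k l + moment1 f l k| else 0

end

end ElasticWave

/-!
On the Fourier side the Lamé system decouples: with `ω = ξ/|ξ|`, the part of `û` orthogonal to `ω`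
oscillates with frequency `a |ξ|`, `a = 2π √μ`, and the part along `ω` with frequency `b |ξ|`,
`b = 2π √(λ + 2μ)`. Hence
`û_N(t) = cos(a|ξ|t) A₀ + cos(b|ξ|t) B₀ + sin(a|ξ|t)/(a|ξ|) A₁ + sin(b|ξ|t)/(b|ξ|) B₁`,
where `B_j = ω_N (ω · f̂_j)` and `A_j = f̂_{jN} - B_j` (`IsSolution.fhat_ae_eq`). The equation is only
known in the sense of distributions, so the formula is derived by duality: the pairing of `û` with
the explicit solution of the adjoint Cauchy problem, localised by a test function supported away
from `ξ = 0`, does not depend on time (`IsSolution.duality`).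

By Plancherel, the norm of `u_N(t)` is the `L²` norm of that expression. The upper bound uses the
inequality `|f̂(ξ) - ∫ f| ≤ 2π |ξ| ‖f‖_{1,1}`, which leaves `∫_{|ξ|<1} (sin(c|ξ|t)/(c|ξ|))² dξ` as
the only growing contribution. In the plane the scaling `ξ ↦ ξ/2` shows that this integral over the
unit disc changes between `t/2` and `t` by an integral over the ring `1/2 ≤ |ξ| < 1`, which is
bounded; summing over the dyadic scales gives `log (t + 2)`
(`exists_setIntegral_sinKernel_sq_le`).

The lower bounds rest on a Riemann-Lebesgue lemma with the phase `|ξ|`, obtained from the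
one-dimensional one in polar coordinates: oscillations with the distinct frequencies `±a |ξ|`,
`±b |ξ|` become orthogonal in `L²` of any compact set (`tendsto_integral_norm_sq_sum`). Since
`a ≠ b`, the norm of `u_N(t)` stays away from zero unless `A₀, A₁, B₀, B₁` all vanish. If they do,
then `f̂_{jN} = 0` and `ξ · f̂_j(ξ) = 0`, and the Taylor expansion of these identities at `ξ = 0`
annihilates the first moments of the `N`-th component and the symmetric part of the matrix of first
moments, that is, all of `absPP` (`exists_transv_or_longit_ne_zero`). When `n = 2` and the total
initial velocity does not vanish, the same lemma bounds the contribution of each dyadic ring from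
below, and the norm grows like `√(log t)` (`exists_le_setIntegral_lead_sq`).
-/

namespace ElasticWave

open Filter Topology FourierTransform
open scoped ContDiff

noncomputable section

/-! ### The Fourier transform of the Lamé operator -/

/-- The Fourier transform `L²(ℝⁿ; ℝ) → L²(ℝⁿ; ℂ)`, with the kernel `e^{-2πi x·ξ}`. -/
def fhat {n : ℕ} : L2 n →L[ℝ] Lp ℂ 2 (volume : Measure (E n)) :=
  ((Lp.fourierTransformₗᵢ (E n) ℂ).toContinuousLinearEquiv.toContinuousLinearMap.restrictScalars
    ℝ).comp (Complex.ofRealCLM.compLpL 2 volume)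

lemma fhat_apply {n : ℕ} (f : L2 n) : fhat f = 𝓕 (Complex.ofRealCLM.compLp f) := rfl

lemma norm_fhat {n : ℕ} (f : L2 n) : ‖fhat f‖ = ‖f‖ := by
  rw [fhat_apply, Lp.norm_fourier_eq, Lp.norm_def, Lp.norm_def]
  congr 1
  refine eLpNorm_congr_norm_ae ?_
  filter_upwards [Complex.ofRealCLM.coeFn_compLp f] with x hx
  rw [hx]
  simp

lemma toDistr_apply {n : ℕ} (f : L2 n) (φ : 𝓢(E n, ℂ)) :
    toDistr f φ = ∫ x, φ x * (f x : ℂ) := by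
  rw [toDistr, Lp.toTemperedDistribution_apply]
  refine integral_congr_ae ?_
  filter_upwards [Complex.ofRealCLM.coeFn_compLp f] with x hx
  rw [hx]
  simp

/-- The Fourier transform of tempered distributions agrees with the one on `L²`. -/
lemma toDistr_fourier {n : ℕ} (f : L2 n) (φ : 𝓢(E n, ℂ)) :
    toDistr f (𝓕 φ) = ∫ ξ, φ ξ * fhat f ξ := by
  rw [← TemperedDistribution.fourier_apply, toDistr, Lp.fourier_toTemperedDistribution_eq,
    Lp.toTemperedDistribution_apply]
  rfl

lemma MemL11.integrable {n : ℕ} {f : L2 n} (hf : MemL11 f) : Integrable f := by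
  refine hf.mono (Lp.aestronglyMeasurable f) (ae_of_all _ fun x => ?_)
  rw [norm_mul]
  refine le_mul_of_one_le_left (norm_nonneg _) ?_
  rw [Real.norm_of_nonneg (by positivity)]
  linarith [norm_nonneg x]

lemma MemL11.integrable_norm_mul {n : ℕ} {f : L2 n} (hf : MemL11 f) :
    Integrable (fun x => ‖x‖ * ‖f x‖) := by
  refine hf.mono ((continuous_norm.aestronglyMeasurable).mul
    (Lp.aestronglyMeasurable f).norm) (ae_of_all _ fun x => ?_)
  rw [norm_mul, norm_mul, norm_norm, norm_norm]
  refine mul_le_mul_of_nonneg_right ?_ (norm_nonneg _)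
  rw [Real.norm_of_nonneg (by positivity)]
  linarith

/-- The continuous representative of the Fourier transform of an integrable function of `L²`. -/
def ft {n : ℕ} (f : L2 n) (ξ : E n) : ℂ := 𝓕 (fun x => (f x : ℂ)) ξ

lemma continuous_ft {n : ℕ} {f : L2 n} (hf : Integrable f) : Continuous (ft f) :=
  VectorFourier.fourierIntegral_continuous Real.continuous_fourierChar
    (by exact continuous_inner) hf.ofReal

/-- For an integrable function the Fourier transform in `L²` is the Fourier integral. -/
lemma fhat_ae_eq {n : ℕ} {f : L2 n} (hf : Integrable f) : fhat f =ᵐ[volume] ft f := by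
  have hli : LocallyIntegrable (fun ξ => fhat f ξ - ft f ξ) volume :=
    ((Lp.memLp (fhat f)).locallyIntegrable (by norm_num)).sub
      (continuous_ft hf).locallyIntegrable
  have := ae_eq_zero_of_integral_contDiff_smul_eq_zero hli ?_
  · filter_upwards [this] with ξ h using sub_eq_zero.1 h
  intro g hg hgc
  have hg' : ContDiff ℝ ∞ (fun x => (g x : ℂ)) := Complex.ofRealCLM.contDiff.comp hg
  have hgc' : HasCompactSupport (fun x => (g x : ℂ)) :=
    hgc.comp_left (g := fun t : ℝ => (t : ℂ)) Complex.ofReal_zero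
  set φ : 𝓢(E n, ℂ) := hgc'.toSchwartzMap hg'
  have hφ : ∀ x, φ x = (g x : ℂ) := fun x => rfl
  have h1 : ∫ ξ, φ ξ * fhat f ξ = ∫ ξ, φ ξ * ft f ξ := by
    rw [← toDistr_fourier, toDistr_apply]
    have := VectorFourier.integral_fourierIntegral_smul_eq_flip (μ := volume) (ν := volume)
      (L := innerₗ (E n)) Real.continuous_fourierChar (by exact continuous_inner)
      φ.integrable hf.ofReal (F := ℂ)
    rw [flip_innerₗ] at this
    exact this
  have hb : Integrable (fun ξ => φ ξ * fhat f ξ) := by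
    have : MemLp φ 2 volume := φ.memLp 2 volume
    exact this.integrable_mul (Lp.memLp (fhat f))
  have hc : Integrable (fun ξ => φ ξ * ft f ξ) :=
    (φ.continuous.mul (continuous_ft hf)).integrable_of_hasCompactSupport hgc'.mul_right
  calc ∫ x, g x • (fhat f x - ft f x) = ∫ x, (φ x * fhat f x - φ x * ft f x) := by
        refine integral_congr_ae (ae_of_all _ fun x => ?_)
        simp only [hφ, Complex.real_smul]; ring
    _ = 0 := by rw [integral_sub hb hc, h1, sub_self]

lemma inner_unitVec {n : ℕ} (ξ : E n) (i : Fin n) : inner ℝ ξ (unitVec i) = ξ i := by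
  rw [unitVec, EuclideanSpace.inner_single_right]
  simp

/-- Multiplication of a Schwartz function by the `i`-th coordinate. -/
def coordMul {n : ℕ} (i : Fin n) (φ : 𝓢(E n, ℂ)) : 𝓢(E n, ℂ) :=
  SchwartzMap.smulLeftCLM ℂ (fun ξ : E n => inner ℝ ξ (unitVec i)) φ

lemma coordMul_apply {n : ℕ} (i : Fin n) (φ : 𝓢(E n, ℂ)) (ξ : E n) :
    coordMul i φ ξ = (ξ i : ℂ) * φ ξ := by
  have : (fun ξ : E n => inner ℝ ξ (unitVec i)).HasTemperateGrowth := by fun_prop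
  rw [coordMul, SchwartzMap.smulLeftCLM_apply_apply this, inner_unitVec, Complex.real_smul]

lemma lineDeriv_lineDeriv_fourier {n : ℕ} (i j : Fin n) (φ : 𝓢(E n, ℂ)) :
    ∂_{(unitVec i : E n)} (∂_{(unitVec j : E n)} (𝓕 φ)) =
      𝓕 ((-(4 * (Real.pi : ℂ) ^ 2)) • coordMul i (coordMul j φ)) := by
  rw [SchwartzMap.lineDerivOp_fourier_eq, SchwartzMap.lineDerivOp_fourier_eq]
  congr 1
  ext ξ
  change (-(2 * (Real.pi : ℂ) * Complex.I)) • (coordMul i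
    ((-(2 * (Real.pi : ℂ) * Complex.I)) • coordMul j φ)) ξ =
    (-(4 * (Real.pi : ℂ) ^ 2)) • (coordMul i (coordMul j φ)) ξ
  simp only [coordMul_apply, smul_apply, smul_eq_mul]
  linear_combination (4 * (Real.pi : ℂ) ^ 2 * (ξ i : ℂ) * ((ξ j : ℂ) * φ ξ)) * Complex.I_sq

lemma toDistr_lineDeriv_lineDeriv_fourier {n : ℕ} (f : L2 n) (i j : Fin n) (φ : 𝓢(E n, ℂ)) :
    toDistr f (∂_{(unitVec i : E n)} (∂_{(unitVec j : E n)} (𝓕 φ))) =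
      ∫ ξ, (-(4 * (Real.pi : ℂ) ^ 2)) * (ξ i * ξ j * φ ξ) * fhat f ξ := by
  rw [lineDeriv_lineDeriv_fourier, toDistr_fourier]
  refine integral_congr_ae (ae_of_all _ fun ξ => ?_)
  simp only [coordMul_apply, smul_apply, smul_eq_mul]
  ring

lemma integrable_coord_mul_coord_mul {n : ℕ} (f : L2 n) (i j : Fin n) (φ : 𝓢(E n, ℂ)) :
    Integrable (fun ξ => (-(4 * (Real.pi : ℂ) ^ 2)) * (ξ i * ξ j * φ ξ) * fhat f ξ) := by
  have : MemLp (coordMul i (coordMul j φ)) 2 volume := SchwartzMap.memLp _ 2 volume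
  refine ((this.integrable_mul (Lp.memLp (fhat f))).const_mul
    (-(4 * (Real.pi : ℂ) ^ 2))).congr (ae_of_all _ fun ξ => ?_)
  simp only [coordMul_apply, Pi.mul_apply]
  ring

/-- The entry `(j, k)` of the symbol `-4π² (μ |ξ|² δ_{jk} + (λ + μ) ξ_j ξ_k)` of the Lamé operator
`μ Δ + (λ + μ) ∇ div`. -/
def symbol {n : ℕ} (lam mu : ℝ) (ξ : E n) (j k : Fin n) : ℝ :=
  -(4 * Real.pi ^ 2) * (mu * (if j = k then ‖ξ‖ ^ 2 else 0) + (lam + mu) * (ξ j * ξ k))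

/-- On the Fourier side the Lamé operator is multiplication by its (symmetric) symbol. -/
lemma lame_fourier {n : ℕ} (lam mu : ℝ) (w : Fin n → L2 n) (k : Fin n) (φ : 𝓢(E n, ℂ)) :
    lame lam mu w k (𝓕 φ) = ∑ j, ∫ ξ, ((symbol lam mu ξ j k : ℂ) * φ ξ) * fhat (w j) ξ := by
  have hlap : (Δ (toDistr (w k))) (𝓕 φ) =
      ∑ i, toDistr (w k) (∂_{(unitVec i : E n)} (∂_{(unitVec i : E n)} (𝓕 φ))) := by
    rw [TemperedDistribution.laplacian_apply_apply,
      SchwartzMap.laplacian_eq_sum (EuclideanSpace.basisFun (Fin n) ℝ), map_sum]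
    simp [unitVec]
  have hdiv : (∂_{(unitVec k : E n)} (divergence w)) (𝓕 φ) =
      ∑ j, toDistr (w j) (∂_{(unitVec j : E n)} (∂_{(unitVec k : E n)} (𝓕 φ))) := by
    rw [TemperedDistribution.lineDerivOp_apply_apply, divergence]
    simp only [sum_apply, TemperedDistribution.lineDerivOp_apply_apply, map_neg,
      Finset.sum_neg_distrib, neg_neg]
  have h0 : lame lam mu w k (𝓕 φ) = (mu : ℂ) * (Δ (toDistr (w k))) (𝓕 φ)
      + ((lam + mu : ℝ) : ℂ) * (∂_{(unitVec k : E n)} (divergence w)) (𝓕 φ) := rfl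
  rw [h0, hlap, hdiv]
  simp only [toDistr_lineDeriv_lineDeriv_fourier]
  have hI := fun f => integrable_coord_mul_coord_mul (n := n) f (φ := φ)
  have e1 : (mu : ℂ) * ∑ i, ∫ ξ, (-(4 * (Real.pi : ℂ) ^ 2)) * (ξ i * ξ i * φ ξ) * fhat (w k) ξ
      = ∑ j, if j = k then ∫ ξ, (mu : ℂ) * ∑ i, (-(4 * (Real.pi : ℂ) ^ 2)) *
        (ξ i * ξ i * φ ξ) * fhat (w j) ξ else 0 := by
    rw [Finset.sum_ite_eq' Finset.univ k, if_pos (Finset.mem_univ _), integral_const_mul,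
      integral_finsetSum _ fun i _ => hI _ i i]
  rw [e1, Finset.mul_sum, ← Finset.sum_add_distrib]
  refine Finset.sum_congr rfl fun j _ => ?_
  have hs : ∀ ξ : E n, ((‖ξ‖ ^ 2 : ℝ) : ℂ) = ∑ i, (ξ i : ℂ) * ξ i := by
    intro ξ
    rw [EuclideanSpace.norm_sq_eq]
    push_cast
    refine Finset.sum_congr rfl fun i _ => ?_
    rw [← Complex.ofReal_pow, Real.norm_eq_abs, sq_abs]
    push_cast; ring
  rw [← integral_const_mul]
  split_ifs with hjk
  · rw [← integral_add ((integrable_finsetSum _ fun i _ => hI _ i i).const_mul _)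
      ((hI _ j k).const_mul _)]
    refine integral_congr_ae (ae_of_all _ fun ξ => ?_)
    simp only [symbol, if_pos hjk]
    push_cast
    have := hs ξ
    push_cast at this
    rw [this, ← Finset.sum_mul, ← Finset.mul_sum, ← Finset.sum_mul]
    ring
  · rw [zero_add]
    refine integral_congr_ae (ae_of_all _ fun ξ => ?_)
    simp only [symbol, if_neg hjk]
    push_cast
    ring

/-! ### Test functions -/

/-- Smooth real functions with compact support in `ℝⁿ \ {0}`. The origin is excluded because the
frequencies `c |ξ|` and the direction `ξ/|ξ|` are not smooth there. -/
structure IsTest {n : ℕ} (q : E n → ℝ) : Prop where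
  contDiff : ContDiff ℝ ∞ q
  compact : HasCompactSupport q
  zero_notMem : (0 : E n) ∉ tsupport q

lemma IsTest.mul {n : ℕ} {q g : E n → ℝ} (hq : IsTest q)
    (hg : ∀ ξ : E n, ξ ≠ 0 → ContDiffAt ℝ ∞ g ξ) : IsTest (fun ξ => q ξ * g ξ) := by
  refine ⟨contDiff_iff_contDiffAt.2 fun ξ => ?_, hq.compact.mul_right, fun h =>
    hq.zero_notMem (tsupport_mul_subset_left h)⟩
  by_cases hξ : ξ ∈ tsupport q
  · exact hq.contDiff.contDiffAt.mul (hg ξ fun h => hq.zero_notMem (h ▸ hξ))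
  · have h0 : (fun ξ => q ξ * g ξ) =ᶠ[𝓝 ξ] fun _ => 0 := by
      filter_upwards [notMem_tsupport_iff_eventuallyEq.1 hξ] with x hx
      simp [hx]
    exact contDiffAt_const.congr_of_eventuallyEq h0

lemma IsTest.add {n : ℕ} {q p : E n → ℝ} (hq : IsTest q) (hp : IsTest p) :
    IsTest (fun ξ => q ξ + p ξ) := by
  refine ⟨hq.contDiff.add hp.contDiff, hq.compact.add hp.compact, fun h => ?_⟩
  rcases (tsupport_add (f := q) (g := p)) h with h | h
  · exact hq.zero_notMem h
  · exact hp.zero_notMem h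

lemma IsTest.memLp {n : ℕ} {q : E n → ℝ} (hq : IsTest q) : MemLp q 2 :=
  hq.contDiff.continuous.memLp_of_hasCompactSupport hq.compact

/-- A test function as a complex Schwartz function. -/
def IsTest.schwartz {n : ℕ} {q : E n → ℝ} (hq : IsTest q) : 𝓢(E n, ℂ) :=
  (hq.compact.comp_left (g := fun t : ℝ => (t : ℂ)) Complex.ofReal_zero).toSchwartzMap
    (Complex.ofRealCLM.contDiff.comp hq.contDiff)

lemma IsTest.schwartz_apply {n : ℕ} {q : E n → ℝ} (hq : IsTest q) (ξ : E n) :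
    hq.schwartz ξ = (q ξ : ℂ) := rfl

open Classical in
/-- The class in `L²(ℝⁿ; ℂ)` of a real function, with value `0` if it is not in `L²`. -/
def toC {n : ℕ} (q : E n → ℝ) : Lp ℂ 2 (volume : Measure (E n)) :=
  if h : MemLp (fun ξ => (q ξ : ℂ)) 2 volume then h.toLp else 0

lemma coeFn_toC {n : ℕ} {q : E n → ℝ} (hq : MemLp q 2) :
    toC q =ᵐ[volume] fun ξ => (q ξ : ℂ) := by
  have h : MemLp (fun ξ => (q ξ : ℂ)) 2 volume := hq.ofReal
  rw [toC, dif_pos h]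
  exact h.coeFn_toLp

lemma inner_toC {n : ℕ} {q : E n → ℝ} (hq : MemLp q 2) (W : Lp ℂ 2 (volume : Measure (E n))) :
    inner ℂ (toC q) W = ∫ ξ, (q ξ : ℂ) * W ξ := by
  rw [L2.inner_def]
  refine integral_congr_ae ?_
  filter_upwards [coeFn_toC hq] with ξ hξ
  simp [hξ, mul_comm]

lemma integrable_mul_Lp {n : ℕ} {q : E n → ℝ} (hq : MemLp q 2)
    (W : Lp ℂ 2 (volume : Measure (E n))) : Integrable (fun ξ => (q ξ : ℂ) * W ξ) :=
  MemLp.integrable_mul (p := 2) (q := 2) hq.ofReal (Lp.memLp W)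

/-! ### Differentiation of moving test functions -/

lemma abs_taylor_le {f f' f'' : ℝ → ℝ} {M : ℝ} (h1 : ∀ t, HasDerivAt f (f' t) t)
    (h2 : ∀ t, HasDerivAt f' (f'' t) t) (hM : ∀ t, |f'' t| ≤ M) (s t : ℝ) :
    |f t - f s - (t - s) * f' s| ≤ (t - s) ^ 2 * M := by
  have hf' : ∀ x, |f' x - f' s| ≤ M * |x - s| := fun x =>
    convex_univ.norm_image_sub_le_of_norm_hasDerivWithin_le
      (fun y _ => (h2 y).hasDerivWithinAt) (fun y _ => hM y) (mem_univ s) (mem_univ x)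
  have hM0 : 0 ≤ M := (abs_nonneg _).trans (hM 0)
  have := (convex_uIcc s t).norm_image_sub_le_of_norm_hasDerivWithin_le (C := M * |t - s|)
    (f := fun x => f x - x * f' s) (f' := fun x => f' x - f' s)
    (fun y _ => by
      simpa [Pi.sub_def] using ((h1 y).sub ((hasDerivAt_id y).mul_const (f' s))).hasDerivWithinAt)
    (fun y hy => (hf' y).trans (mul_le_mul_of_nonneg_left
      (abs_sub_left_of_mem_uIcc hy) hM0)) left_mem_uIcc right_mem_uIcc
  calc |f t - f s - (t - s) * f' s| = ‖f t - t * f' s - (f s - s * f' s)‖ := by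
        rw [Real.norm_eq_abs]; congr 1; ring
    _ ≤ M * |t - s| * ‖t - s‖ := this
    _ = (t - s) ^ 2 * M := by rw [Real.norm_eq_abs, mul_assoc, abs_mul_abs_self]; ring

/-- A family of functions that is differentiable in a parameter at every point, with a second
derivative dominated by a function of `L²`, is differentiable in `L²`. -/
lemma hasDerivAt_toC {n : ℕ} {Ψ Ψ' Ψ'' : ℝ → E n → ℝ} {g : E n → ℝ}
    (m0 : ∀ t, MemLp (Ψ t) 2) (m1 : ∀ t, MemLp (Ψ' t) 2) (mg : MemLp g 2)
    (h1 : ∀ ξ t, HasDerivAt (fun t => Ψ t ξ) (Ψ' t ξ) t)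
    (h2 : ∀ ξ t, HasDerivAt (fun t => Ψ' t ξ) (Ψ'' t ξ) t)
    (hg : ∀ ξ t, |Ψ'' t ξ| ≤ g ξ) (s : ℝ) :
    HasDerivAt (fun t => toC (Ψ t)) (toC (Ψ' s)) s := by
  rw [hasDerivAt_iff_isLittleO]
  have hO : (fun t => toC (Ψ t) - toC (Ψ s) - (t - s) • toC (Ψ' s)) =O[𝓝 s]
      fun t => (t - s) ^ 2 := by
    refine Asymptotics.IsBigO.of_bound ‖toC g‖ (Eventually.of_forall fun t => ?_)
    have : ‖toC (Ψ t) - toC (Ψ s) - (t - s) • toC (Ψ' s)‖ ≤ ‖(t - s) ^ 2 • toC g‖ := by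
      refine Lp.norm_le_norm_of_ae_le ?_
      filter_upwards [coeFn_toC (m0 t), coeFn_toC (m0 s), coeFn_toC (m1 s), coeFn_toC mg,
        Lp.coeFn_sub (toC (Ψ t) - toC (Ψ s)) ((t - s) • toC (Ψ' s)),
        Lp.coeFn_sub (toC (Ψ t)) (toC (Ψ s)), Lp.coeFn_smul (t - s) (toC (Ψ' s)),
        Lp.coeFn_smul ((t - s) ^ 2) (toC g)] with ξ e1 e2 e3 e4 e5 e6 e7 e8
      rw [e5, Pi.sub_apply, e6, Pi.sub_apply, e7, e8, Pi.smul_apply, Pi.smul_apply, e1, e2, e3, e4,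
        Complex.real_smul, Complex.real_smul]
      norm_cast
      rw [Real.norm_eq_abs, Real.norm_eq_abs]
      exact (abs_taylor_le (h1 ξ) (h2 ξ) (hg ξ) s t).trans (le_abs_self _)
    rw [norm_smul, mul_comm] at this
    exact this
  refine hO.trans_isLittleO ?_
  have := Asymptotics.isLittleO_pow_pow (𝕜 := ℝ) (m := 1) (n := 2) one_lt_two
  simpa [Function.comp_def] using this.comp_tendsto
    (tendsto_sub_nhds_zero_iff.2 (tendsto_id (x := 𝓝 s)))

/-- Product rule for a pairing in which the second factor is only weakly differentiable. -/
lemma hasDerivAt_inner_of_weak {H : Type*} [NormedAddCommGroup H] [InnerProductSpace ℂ H]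
    {P w : ℝ → H} {P' : H} {d : ℂ} {s : ℝ} (hP : HasDerivAt P P' s) (hw : ContinuousAt w s)
    (hd : HasDerivAt (fun t => inner ℂ (P s) (w t)) d s) :
    HasDerivAt (fun t => inner ℂ (P t) (w t)) (d + inner ℂ P' (w s)) s := by
  have h2 : HasDerivAt (fun t => inner ℂ (P t - P s) (w t)) (inner ℂ P' (w s)) s := by
    rw [hasDerivAt_iff_tendsto_slope] at hP ⊢
    refine (hP.inner (hw.tendsto.mono_left nhdsWithin_le_nhds)).congr fun t => ?_
    rw [slope_def_module, slope_def_module, ← Complex.coe_smul, inner_smul_left,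
      Complex.conj_ofReal]
    simp [inner_sub_left]
  refine (hd.add h2).congr_of_eventuallyEq (Eventually.of_forall fun t => ?_)
  simp

/-! ### The adjoint Cauchy problem -/

/-- A superposition of oscillations in `T - t` with the frequencies `a |ξ|` and `b |ξ|`. -/
def osc {n : ℕ} (a b T : ℝ) (p₀ p₁ p₂ p₃ : E n → ℝ) (t : ℝ) (ξ : E n) : ℝ :=
  p₀ ξ * Real.cos (a * ‖ξ‖ * (T - t)) + p₁ ξ * Real.sin (a * ‖ξ‖ * (T - t)) +
    p₂ ξ * Real.cos (b * ‖ξ‖ * (T - t)) + p₃ ξ * Real.sin (b * ‖ξ‖ * (T - t))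

lemma contDiffAt_const_mul_norm {n : ℕ} (c : ℝ) {ξ : E n} (hξ : ξ ≠ 0) :
    ContDiffAt ℝ ∞ (fun ξ : E n => c * ‖ξ‖) ξ :=
  contDiffAt_const.mul (contDiffAt_norm ℝ hξ)

lemma IsTest.osc {n : ℕ} {a b T : ℝ} {p₀ p₁ p₂ p₃ : E n → ℝ} (h₀ : IsTest p₀) (h₁ : IsTest p₁)
    (h₂ : IsTest p₂) (h₃ : IsTest p₃) (t : ℝ) : IsTest (osc a b T p₀ p₁ p₂ p₃ t) := by
  have hc : ∀ c : ℝ, ∀ ξ : E n, ξ ≠ 0 →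
      ContDiffAt ℝ ∞ (fun ξ : E n => Real.cos (c * ‖ξ‖ * (T - t))) ξ := fun c ξ hξ =>
    Real.contDiff_cos.contDiffAt.comp ξ ((contDiffAt_const_mul_norm c hξ).mul contDiffAt_const)
  have hs : ∀ c : ℝ, ∀ ξ : E n, ξ ≠ 0 →
      ContDiffAt ℝ ∞ (fun ξ : E n => Real.sin (c * ‖ξ‖ * (T - t))) ξ := fun c ξ hξ =>
    Real.contDiff_sin.contDiffAt.comp ξ ((contDiffAt_const_mul_norm c hξ).mul contDiffAt_const)
  exact (((h₀.mul (hc a)).add (h₁.mul (hs a))).add (h₂.mul (hc b))).add (h₃.mul (hs b))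

lemma hasDerivAt_osc {n : ℕ} (a b T : ℝ) (p₀ p₁ p₂ p₃ : E n → ℝ) (ξ : E n) (t : ℝ) :
    HasDerivAt (fun t => osc a b T p₀ p₁ p₂ p₃ t ξ)
      (osc a b T (fun ξ => p₁ ξ * (-a * ‖ξ‖)) (fun ξ => p₀ ξ * (a * ‖ξ‖))
        (fun ξ => p₃ ξ * (-b * ‖ξ‖)) (fun ξ => p₂ ξ * (b * ‖ξ‖)) t ξ) t := by
  have hl : ∀ c : ℝ, HasDerivAt (fun t => c * ‖ξ‖ * (T - t)) (-(c * ‖ξ‖)) t := fun c => by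
    simpa using ((hasDerivAt_id t).const_sub T).const_mul (c * ‖ξ‖)
  have := ((((hl a).cos.const_mul (p₀ ξ)).add ((hl a).sin.const_mul (p₁ ξ))).add
    ((hl b).cos.const_mul (p₂ ξ))).add ((hl b).sin.const_mul (p₃ ξ))
  refine this.congr_deriv ?_
  simp only [osc]
  ring

lemma abs_osc_le {n : ℕ} (a b T : ℝ) (p₀ p₁ p₂ p₃ : E n → ℝ) (ξ : E n) (t : ℝ) :
    |osc a b T p₀ p₁ p₂ p₃ t ξ| ≤ |p₀ ξ| + |p₁ ξ| + |p₂ ξ| + |p₃ ξ| := by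
  have hc : ∀ x y : ℝ, |x * Real.cos y| ≤ |x| := fun x y => by
    rw [abs_mul]; exact mul_le_of_le_one_right (abs_nonneg _) (Real.abs_cos_le_one y)
  have hs : ∀ x y : ℝ, |x * Real.sin y| ≤ |x| := fun x y => by
    rw [abs_mul]; exact mul_le_of_le_one_right (abs_nonneg _) (Real.abs_sin_le_one y)
  rw [osc]
  refine (abs_add_le _ _).trans (add_le_add ((abs_add_le _ _).trans
    (add_le_add ((abs_add_le _ _).trans (add_le_add (hc _ _) (hs _ _))) (hc _ _))) (hs _ _))

lemma IsTest.mul_norm {n : ℕ} {q : E n → ℝ} (hq : IsTest q) (c : ℝ) :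
    IsTest (fun ξ => q ξ * (c * ‖ξ‖)) :=
  hq.mul fun _ hξ => contDiffAt_const_mul_norm c hξ

lemma hasDerivAt_toC_osc {n : ℕ} {a b T : ℝ} {p₀ p₁ p₂ p₃ : E n → ℝ} (h₀ : IsTest p₀)
    (h₁ : IsTest p₁) (h₂ : IsTest p₂) (h₃ : IsTest p₃) (t : ℝ) :
    HasDerivAt (fun t => toC (osc a b T p₀ p₁ p₂ p₃ t))
      (toC (osc a b T (fun ξ => p₁ ξ * (-a * ‖ξ‖)) (fun ξ => p₀ ξ * (a * ‖ξ‖))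
        (fun ξ => p₃ ξ * (-b * ‖ξ‖)) (fun ξ => p₂ ξ * (b * ‖ξ‖)) t)) t := by
  have k₀ := (h₁.mul_norm (-a))
  have k₁ := (h₀.mul_norm a)
  have k₂ := (h₃.mul_norm (-b))
  have k₃ := (h₂.mul_norm b)
  exact hasDerivAt_toC (fun t => (h₀.osc h₁ h₂ h₃ t).memLp) (fun t => (k₀.osc k₁ k₂ k₃ t).memLp)
    ((((k₁.mul_norm (-a)).memLp.abs.add (k₀.mul_norm a).memLp.abs).add
      (k₃.mul_norm (-b)).memLp.abs).add (k₂.mul_norm b).memLp.abs)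
    (hasDerivAt_osc a b T p₀ p₁ p₂ p₃) (hasDerivAt_osc a b T _ _ _ _)
    (fun ξ t => abs_osc_le a b T _ _ _ _ ξ t) t

lemma isTest_zero {n : ℕ} : IsTest (fun _ : E n => (0 : ℝ)) :=
  ⟨contDiff_const, HasCompactSupport.zero, by simp [tsupport]⟩

/-- The factor `2π √c` for which solutions of `∂ₜ² v = c Δ v` oscillate with frequency
`freq c * |ξ|` on the Fourier side. -/
def freq (c : ℝ) : ℝ := 2 * Real.pi * √c

lemma freq_pos {c : ℝ} (hc : 0 < c) : 0 < freq c := by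
  have := Real.sqrt_pos.2 hc
  have := Real.pi_pos
  unfold freq; positivity

lemma freq_sq {c : ℝ} (hc : 0 ≤ c) : freq c ^ 2 = 4 * Real.pi ^ 2 * c := by
  rw [freq, mul_pow, Real.sq_sqrt hc]; ring

/-- Entry of the orthogonal projection onto the direction of `ξ`, with value `0` at `ξ = 0`. -/
def proj {n : ℕ} (j k : Fin n) (ξ : E n) : ℝ := ξ j * ξ k / ‖ξ‖ ^ 2

lemma contDiffAt_coord {n : ℕ} (i : Fin n) (ξ : E n) : ContDiffAt ℝ ∞ (fun ξ : E n => ξ i) ξ :=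
  (EuclideanSpace.proj (𝕜 := ℝ) i).contDiff.contDiffAt

lemma contDiffAt_proj {n : ℕ} (j k : Fin n) {ξ : E n} (hξ : ξ ≠ 0) :
    ContDiffAt ℝ ∞ (proj j k) ξ :=
  ((contDiffAt_coord j ξ).mul (contDiffAt_coord k ξ)).div ((contDiffAt_norm ℝ hξ).pow 2)
    (pow_ne_zero 2 (norm_ne_zero_iff.2 hξ))

lemma contDiffAt_symbol {n : ℕ} (lam mu : ℝ) (j k : Fin n) {ξ : E n} (hξ : ξ ≠ 0) :
    ContDiffAt ℝ ∞ (fun ξ : E n => symbol lam mu ξ j k) ξ := by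
  refine contDiffAt_const.mul ((contDiffAt_const.mul ?_).add
    (contDiffAt_const.mul ((contDiffAt_coord j ξ).mul (contDiffAt_coord k ξ))))
  split_ifs
  · exact (contDiffAt_norm ℝ hξ).pow 2
  · exact contDiffAt_const

lemma contDiffAt_inv_norm {n : ℕ} {c : ℝ} (hc : c ≠ 0) {ξ : E n} (hξ : ξ ≠ 0) :
    ContDiffAt ℝ ∞ (fun ξ : E n => (c * ‖ξ‖)⁻¹) ξ :=
  (contDiffAt_const_mul_norm c hξ).inv (mul_ne_zero hc (norm_ne_zero_iff.2 hξ))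

/-- The amplitude of the transversal part of the adjoint solution with final velocity `-χ e_N`. -/
def ampT {n : ℕ} (a : ℝ) (χ : E n → ℝ) (N k : Fin n) (ξ : E n) : ℝ :=
  χ ξ * (((if k = N then 1 else 0) - proj N k ξ) * (a * ‖ξ‖)⁻¹)

/-- The amplitude of the longitudinal part of the adjoint solution with final velocity
`-χ e_N`. -/
def ampL {n : ℕ} (b : ℝ) (χ : E n → ℝ) (N k : Fin n) (ξ : E n) : ℝ :=
  χ ξ * (proj N k ξ * (b * ‖ξ‖)⁻¹)

lemma IsTest.ampT {n : ℕ} {a : ℝ} (ha : a ≠ 0) {χ : E n → ℝ} (hχ : IsTest χ) (N k : Fin n) :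
    IsTest (ampT a χ N k) :=
  hχ.mul fun _ hξ => (contDiffAt_const.sub (contDiffAt_proj N k hξ)).mul
    (contDiffAt_inv_norm ha hξ)

lemma IsTest.ampL {n : ℕ} {b : ℝ} (hb : b ≠ 0) {χ : E n → ℝ} (hχ : IsTest χ) (N k : Fin n) :
    IsTest (ampL b χ N k) :=
  hχ.mul fun _ hξ => (contDiffAt_proj N k hξ).mul (contDiffAt_inv_norm hb hξ)

lemma sum_mul_self_eq_norm_sq {n : ℕ} (ξ : E n) : ∑ k, ξ k * ξ k = ‖ξ‖ ^ 2 := by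
  rw [EuclideanSpace.norm_sq_eq]
  exact Finset.sum_congr rfl fun i _ => by rw [Real.norm_eq_abs, sq_abs]; ring

lemma sum_coord_mul_proj {n : ℕ} (N : Fin n) {ξ : E n} (hξ : ξ ≠ 0) :
    ∑ k, ξ k * proj N k ξ = ξ N := by
  have h : ‖ξ‖ ≠ 0 := norm_ne_zero_iff.2 hξ
  have : ∀ k, ξ k * proj N k ξ = ξ N / ‖ξ‖ ^ 2 * (ξ k * ξ k) := fun k => by
    rw [proj]; ring
  rw [Finset.sum_congr rfl fun k _ => this k, ← Finset.mul_sum, sum_mul_self_eq_norm_sq]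
  field_simp

/-- The adjoint field `k ↦ χ (sin(a|ξ|s)/(a|ξ|) (δ_{kN} - ω_k ω_N) + sin(b|ξ|s)/(b|ξ|) ω_k ω_N)`
solves the ordinary differential equation given by the symbol of the Lamé operator. -/
lemma sum_symbol_mul_osc {n : ℕ} {lam mu : ℝ} (hmu : 0 < mu) (hlam : 0 < lam + 2 * mu) (T : ℝ)
    {χ : E n → ℝ} (hχ : IsTest χ) (N j : Fin n) (t : ℝ) (ξ : E n) :
    ∑ k, symbol lam mu ξ j k * osc (freq mu) (freq (lam + 2 * mu)) T (fun _ => 0)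
      (ampT (freq mu) χ N k) (fun _ => 0) (ampL (freq (lam + 2 * mu)) χ N k) t ξ =
    osc (freq mu) (freq (lam + 2 * mu)) T (fun _ => 0)
      (fun ξ => ampT (freq mu) χ N j ξ * (-freq mu * ‖ξ‖) * (freq mu * ‖ξ‖)) (fun _ => 0)
      (fun ξ => ampL (freq (lam + 2 * mu)) χ N j ξ * (-freq (lam + 2 * mu) * ‖ξ‖) *
        (freq (lam + 2 * mu) * ‖ξ‖)) t ξ := by
  rcases eq_or_ne ξ 0 with rfl | hξ
  · have : χ 0 = 0 := image_eq_zero_of_notMem_tsupport hχ.zero_notMem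
    simp [osc, ampT, ampL, this]
  set a := freq mu
  set b := freq (lam + 2 * mu)
  have ha2 : a ^ 2 = 4 * Real.pi ^ 2 * mu := freq_sq hmu.le
  have hb2 : b ^ 2 = 4 * Real.pi ^ 2 * (lam + 2 * mu) := freq_sq hlam.le
  set S := (a * ‖ξ‖)⁻¹ * Real.sin (a * ‖ξ‖ * (T - t))
  set R := (b * ‖ξ‖)⁻¹ * Real.sin (b * ‖ξ‖ * (T - t))
  have hr : ‖ξ‖ ≠ 0 := norm_ne_zero_iff.2 hξ
  have hpj : ‖ξ‖ ^ 2 * proj N j ξ = ξ N * ξ j := by rw [proj]; field_simp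
  have hsum := sum_coord_mul_proj N hξ
  have e : ∀ k, symbol lam mu ξ j k * osc a b T (fun _ => 0) (ampT a χ N k) (fun _ => 0)
      (ampL b χ N k) t ξ =
      (-(4 * Real.pi ^ 2) * χ ξ) * ((if j = k then mu * ‖ξ‖ ^ 2 *
        (((if k = N then 1 else 0) - proj N k ξ) * S + proj N k ξ * R) else 0)
        + (lam + mu) * ξ j * ((if k = N then ξ k else 0) * S
          - (ξ k * proj N k ξ) * S + (ξ k * proj N k ξ) * R)) := by
    intro k
    simp only [symbol, osc, ampT, ampL, S, R]
    split_ifs <;> ring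
  simp only [e]
  rw [← Finset.mul_sum, Finset.sum_add_distrib, Finset.sum_ite_eq, if_pos (Finset.mem_univ _),
    ← Finset.mul_sum, Finset.sum_add_distrib, Finset.sum_sub_distrib, ← Finset.sum_mul,
    ← Finset.sum_mul, ← Finset.sum_mul, hsum, Finset.sum_ite_eq', if_pos (Finset.mem_univ _)]
  have e2 : osc a b T (fun _ => 0) (fun ξ => ampT a χ N j ξ * (-a * ‖ξ‖) * (a * ‖ξ‖)) (fun _ => 0)
      (fun ξ => ampL b χ N j ξ * (-b * ‖ξ‖) * (b * ‖ξ‖)) t ξ =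
      -χ ξ * (a ^ 2 * ‖ξ‖ ^ 2 * (((if j = N then 1 else 0) - proj N j ξ) * S) +
        b ^ 2 * ‖ξ‖ ^ 2 * (proj N j ξ * R)) := by
    simp only [osc, ampT, ampL, S, R]
    ring
  rw [e2, ha2, hb2]
  linear_combination (4 * Real.pi ^ 2 * χ ξ * R * (lam + mu)) * hpj

/-! ### Duality -/

lemma IsSolution.hasDerivAt {n : ℕ} {lam mu : ℝ} {f₀ f₁ : Fin n → L2 n} {u : ℝ → Fin n → L2 n}
    (hu : IsSolution lam mu f₀ f₁ u) (k : Fin n) {t : ℝ} (ht : 0 < t) :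
    HasDerivAt (fun s => u s k) (timeDeriv u t k) t :=
  ((hu.contDiffOn k).differentiableOn one_ne_zero t ht.le).hasDerivWithinAt.hasDerivAt
    (Ici_mem_nhds ht)

lemma IsSolution.continuousOn_timeDeriv {n : ℕ} {lam mu : ℝ} {f₀ f₁ : Fin n → L2 n}
    {u : ℝ → Fin n → L2 n} (hu : IsSolution lam mu f₀ f₁ u) (k : Fin n) :
    ContinuousOn (fun t => timeDeriv u t k) (Ici 0) :=
  (hu.contDiffOn k).continuousOn_derivWithin (uniqueDiffOn_Ici 0) le_rfl

/-- Duality with the adjoint field `Ψ`, which satisfies `Ψ(T) = 0` and `∂ₜ Ψ(T) = -χ e_N`: the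
functional `∑ₖ ⟨Ψ_k(t), ∂ₜ û_k(t)⟩ - ⟨∂ₜ Ψ_k(t), û_k(t)⟩` does not depend on time, and it equals
`⟨χ, û_N(T)⟩` at `t = T`. -/
lemma IsSolution.duality {n : ℕ} {lam mu : ℝ} (hmu : 0 < mu) (hlam : 0 < lam + 2 * mu)
    {f₀ f₁ : Fin n → L2 n} {u : ℝ → Fin n → L2 n} (hu : IsSolution lam mu f₀ f₁ u)
    {T : ℝ} (hT : 0 ≤ T) {χ : E n → ℝ} (hχ : IsTest χ) (N : Fin n) :
    ∫ ξ, (χ ξ : ℂ) * fhat (u T N) ξ =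
      ∑ k, ((∫ ξ, (osc (freq mu) (freq (lam + 2 * mu)) T (fun _ => 0) (ampT (freq mu) χ N k)
          (fun _ => 0) (ampL (freq (lam + 2 * mu)) χ N k) 0 ξ : ℂ) * fhat (f₁ k) ξ)
        - ∫ ξ, (osc (freq mu) (freq (lam + 2 * mu)) T
          (fun ξ => ampT (freq mu) χ N k ξ * (-freq mu * ‖ξ‖)) (fun ξ => 0 * (freq mu * ‖ξ‖))
          (fun ξ => ampL (freq (lam + 2 * mu)) χ N k ξ * (-freq (lam + 2 * mu) * ‖ξ‖))
          (fun ξ => 0 * (freq (lam + 2 * mu) * ‖ξ‖)) 0 ξ : ℂ) * fhat (f₀ k) ξ) := by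
  have ha : freq mu ≠ 0 := (freq_pos hmu).ne'
  have hb : freq (lam + 2 * mu) ≠ 0 := (freq_pos hlam).ne'
  have hsum := sum_symbol_mul_osc hmu hlam T hχ N
  set a := freq mu
  set b := freq (lam + 2 * mu)
  have hz := isTest_zero (n := n)
  have tT := fun k => hχ.ampT ha N k
  have tL := fun k => hχ.ampL hb N k
  set Ψ : Fin n → ℝ → E n → ℝ := fun k =>
    osc a b T (fun _ => 0) (ampT a χ N k) (fun _ => 0) (ampL b χ N k) with hΨ
  set Ψ' : Fin n → ℝ → E n → ℝ := fun k => osc a b T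
    (fun ξ => ampT a χ N k ξ * (-a * ‖ξ‖)) (fun ξ => 0 * (a * ‖ξ‖))
    (fun ξ => ampL b χ N k ξ * (-b * ‖ξ‖)) (fun ξ => 0 * (b * ‖ξ‖)) with hΨ'
  set Ψ'' : Fin n → ℝ → E n → ℝ := fun k => osc a b T
    (fun ξ => 0 * (a * ‖ξ‖) * (-a * ‖ξ‖)) (fun ξ => ampT a χ N k ξ * (-a * ‖ξ‖) * (a * ‖ξ‖))
    (fun ξ => 0 * (b * ‖ξ‖) * (-b * ‖ξ‖)) (fun ξ => ampL b χ N k ξ * (-b * ‖ξ‖) * (b * ‖ξ‖))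
    with hΨ''
  have tΨ : ∀ k t, IsTest (Ψ k t) := fun k t => hz.osc (tT k) hz (tL k) t
  have tΨ' : ∀ k t, IsTest (Ψ' k t) := fun k t =>
    ((tT k).mul_norm _).osc (hz.mul_norm _) ((tL k).mul_norm _) (hz.mul_norm _) t
  have dΨ : ∀ k t, HasDerivAt (fun t => toC (Ψ k t)) (toC (Ψ' k t)) t := fun k t =>
    hasDerivAt_toC_osc hz (tT k) hz (tL k) t
  have dΨ' : ∀ k t, HasDerivAt (fun t => toC (Ψ' k t)) (toC (Ψ'' k t)) t := fun k t =>
    hasDerivAt_toC_osc ((tT k).mul_norm _) (hz.mul_norm _) ((tL k).mul_norm _) (hz.mul_norm _) t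
  set G : ℝ → ℂ := fun t => ∑ k, (inner ℂ (toC (Ψ k t)) (fhat (timeDeriv u t k))
    - inner ℂ (toC (Ψ' k t)) (fhat (u t k))) with hG
  have hGc : ContinuousOn G (Icc 0 T) := by
    refine continuousOn_finsetSum _ fun k _ => ContinuousOn.sub ?_ ?_
    · exact ContinuousOn.inner (fun t _ => (dΨ k t).continuousAt.continuousWithinAt)
        (fhat.continuous.comp_continuousOn
          ((hu.continuousOn_timeDeriv k).mono Icc_subset_Ici_self))
    · exact ContinuousOn.inner (fun t _ => (dΨ' k t).continuousAt.continuousWithinAt)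
        (fhat.continuous.comp_continuousOn
          ((hu.contDiffOn k).continuousOn.mono Icc_subset_Ici_self))
  have hsymb : ∀ j k t, IsTest (fun ξ => symbol lam mu ξ j k * Ψ k t ξ) := fun j k t => by
    simpa only [mul_comm] using (tΨ k t).mul fun _ hξ => contDiffAt_symbol lam mu j k hξ
  have hGd : ∀ t ∈ Ioo 0 T, HasDerivAt G 0 t := by
    intro t ht
    have h1 : ∀ k, HasDerivAt (fun s => inner ℂ (toC (Ψ k s)) (fhat (timeDeriv u s k)))
        (∑ j, (∫ ξ, ((symbol lam mu ξ j k * Ψ k t ξ : ℝ) : ℂ) * fhat (u t j) ξ) +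
          inner ℂ (toC (Ψ' k t)) (fhat (timeDeriv u t k))) t := by
      intro k
      refine hasDerivAt_inner_of_weak (dΨ k t) ?_ ?_
      · exact fhat.continuous.continuousAt.comp
          ((hu.continuousOn_timeDeriv k).continuousAt (Ici_mem_nhds ht.1))
      · have h := hu.equation k (𝓕 (tΨ k t).schwartz) t ht.1
        rw [lame_fourier] at h
        simp only [toDistr_fourier, IsTest.schwartz_apply, ← Complex.ofReal_mul] at h
        simpa only [inner_toC (tΨ k t).memLp] using h
    have h2 : ∀ k, HasDerivAt (fun s => inner ℂ (toC (Ψ' k s)) (fhat (u s k)))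
        (inner ℂ (toC (Ψ' k t)) (fhat (timeDeriv u t k)) +
          inner ℂ (toC (Ψ'' k t)) (fhat (u t k))) t := fun k =>
      (dΨ' k t).inner ℂ (fhat.hasFDerivAt.comp_hasDerivAt t (hu.hasDerivAt k ht.1))
    refine (HasDerivAt.fun_sum fun k _ => (h1 k).sub (h2 k)).congr_deriv ?_
    simp only [add_sub_add_right_eq_sub, Finset.sum_sub_distrib,
      add_comm (inner ℂ (toC (Ψ' _ t)) _)]
    -- the symbol is moved to the adjoint field, where it acts as `∂ₜ²`
    rw [Finset.sum_comm, ← Finset.sum_sub_distrib]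
    refine Finset.sum_eq_zero fun j _ => ?_
    have tΨ'' : IsTest (Ψ'' j t) :=
      ((hz.mul_norm _).mul_norm _).osc (((tT j).mul_norm _).mul_norm _) ((hz.mul_norm _).mul_norm _)
        (((tL j).mul_norm _).mul_norm _) t
    rw [inner_toC tΨ''.memLp, ← integral_finsetSum _ fun k _ =>
      integrable_mul_Lp (hsymb j k t).memLp _, sub_eq_zero]
    refine integral_congr_ae (ae_of_all _ fun ξ => ?_)
    dsimp only
    rw [← Finset.sum_mul, ← Complex.ofReal_sum, hsum j t ξ]
    simp only [hΨ'', zero_mul]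
  -- the equation holds for `t > 0` only, hence the use of continuity up to the end points
  have hconst : G T = G 0 := by
    have := intervalIntegral.integral_eq_sub_of_hasDerivAt_of_le hT hGc hGd (by simp)
    rw [intervalIntegral.integral_zero] at this
    exact (sub_eq_zero.1 this.symm)
  have hG0 : G 0 = ∑ k, ((∫ ξ, (Ψ k 0 ξ : ℂ) * fhat (f₁ k) ξ) -
      ∫ ξ, (Ψ' k 0 ξ : ℂ) * fhat (f₀ k) ξ) := by
    simp only [hG, hu.initial_zero, hu.initial_one]
    exact Finset.sum_congr rfl fun k _ => by
      rw [inner_toC (tΨ k 0).memLp, inner_toC (tΨ' k 0).memLp]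
  rw [← hG0, ← hconst]
  have hGT : G T = ∑ k, (if k = N then ∫ ξ, (χ ξ : ℂ) * fhat (u T k) ξ else 0) := by
    refine Finset.sum_congr rfl fun k _ => ?_
    rw [inner_toC (tΨ k T).memLp, inner_toC (tΨ' k T).memLp]
    have e1 : ∀ ξ, Ψ k T ξ = 0 := fun ξ => by simp [hΨ, osc]
    have e2 : ∀ ξ, Ψ' k T ξ = if k = N then -χ ξ else 0 := by
      intro ξ
      rcases eq_or_ne ξ 0 with rfl | hξ
      · have : χ 0 = 0 := image_eq_zero_of_notMem_tsupport hχ.zero_notMem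
        simp [hΨ', osc, this]
      · have hr : ‖ξ‖ ≠ 0 := norm_ne_zero_iff.2 hξ
        simp only [hΨ', osc, ampT, ampL, sub_self, mul_zero, Real.cos_zero, Real.sin_zero]
        field_simp
        split_ifs <;> ring
    simp only [e1, e2]
    split_ifs
    · simp [integral_neg]
    · simp
  rw [hGT, Finset.sum_ite_eq', if_pos (Finset.mem_univ _)]

/-! ### The solution formula -/

/-- The `N`-th component of the longitudinal part of the Fourier transform of a vector field. -/
def longit {n : ℕ} (f : Fin n → L2 n) (N : Fin n) (ξ : E n) : ℂ :=
  ∑ k, (proj N k ξ : ℂ) * ft (f k) ξ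

/-- The `N`-th component of the transversal part of the Fourier transform of a vector field. -/
def transv {n : ℕ} (f : Fin n → L2 n) (N : Fin n) (ξ : E n) : ℂ := ft (f N) ξ - longit f N ξ

/-- The `N`-th component of the Fourier transform at time `t` of the elastic wave with data
`f₀`, `f₁`, whose transversal and longitudinal parts oscillate with the frequencies `a |ξ|` and
`b |ξ|`. The value at `ξ = 0`, where the quotients are `0`, is irrelevant. -/
def waveHat {n : ℕ} (a b : ℝ) (f₀ f₁ : Fin n → L2 n) (N : Fin n) (t : ℝ) (ξ : E n) : ℂ :=
  Real.cos (a * ‖ξ‖ * t) * transv f₀ N ξ + Real.cos (b * ‖ξ‖ * t) * longit f₀ N ξ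
    + (Real.sin (a * ‖ξ‖ * t) / (a * ‖ξ‖) : ℝ) * transv f₁ N ξ
    + (Real.sin (b * ‖ξ‖ * t) / (b * ‖ξ‖) : ℝ) * longit f₁ N ξ

lemma continuousOn_longit {n : ℕ} {f : Fin n → L2 n} (hf : ∀ k, Integrable (f k)) (N : Fin n) :
    ContinuousOn (longit f N) {0}ᶜ :=
  continuousOn_finsetSum _ fun k _ => ContinuousOn.mul
    (Complex.continuous_ofReal.comp_continuousOn fun _ hξ =>
      (contDiffAt_proj N k hξ).continuousAt.continuousWithinAt)
    (continuous_ft (hf k)).continuousOn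

lemma continuousOn_transv {n : ℕ} {f : Fin n → L2 n} (hf : ∀ k, Integrable (f k)) (N : Fin n) :
    ContinuousOn (transv f N) {0}ᶜ :=
  (continuous_ft (hf N)).continuousOn.sub (continuousOn_longit hf N)

lemma continuousOn_waveHat {n : ℕ} {a b : ℝ} (ha : a ≠ 0) (hb : b ≠ 0) {f₀ f₁ : Fin n → L2 n}
    (h₀ : ∀ k, Integrable (f₀ k)) (h₁ : ∀ k, Integrable (f₁ k)) (N : Fin n) (t : ℝ) :
    ContinuousOn (waveHat a b f₀ f₁ N t) {0}ᶜ := by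
  have hc : ∀ c : ℝ, ContinuousOn (fun ξ : E n => (Real.cos (c * ‖ξ‖ * t) : ℂ)) {0}ᶜ := fun c =>
    (by fun_prop : Continuous _).continuousOn
  have hs : ∀ c : ℝ, c ≠ 0 →
      ContinuousOn (fun ξ : E n => ((Real.sin (c * ‖ξ‖ * t) / (c * ‖ξ‖) : ℝ) : ℂ)) {0}ᶜ :=
    fun c hc => Complex.continuous_ofReal.comp_continuousOn
      (ContinuousOn.div (by fun_prop) (by fun_prop)
        fun ξ hξ => mul_ne_zero hc (norm_ne_zero_iff.2 hξ))
  exact ((((hc a).mul (continuousOn_transv h₀ N)).add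
    ((hc b).mul (continuousOn_longit h₀ N))).add
    ((hs a ha).mul (continuousOn_transv h₁ N))).add ((hs b hb).mul (continuousOn_longit h₁ N))

/-- The Fourier transform of the solution is given by the explicit formula. -/
theorem IsSolution.fhat_ae_eq {n : ℕ} {lam mu : ℝ} (hmu : 0 < mu) (hlam : 0 < lam + 2 * mu)
    {f₀ f₁ : Fin n → L2 n} {u : ℝ → Fin n → L2 n} (hu : IsSolution lam mu f₀ f₁ u)
    (h₀ : ∀ k, Integrable (f₀ k)) (h₁ : ∀ k, Integrable (f₁ k)) {t : ℝ} (ht : 0 ≤ t)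
    (N : Fin n) :
    fhat (u t N) =ᵐ[volume] waveHat (freq mu) (freq (lam + 2 * mu)) f₀ f₁ N t := by
  have : Nonempty (Fin n) := ⟨N⟩
  have ha : freq mu ≠ 0 := (freq_pos hmu).ne'
  have hb : freq (lam + 2 * mu) ≠ 0 := (freq_pos hlam).ne'
  have hdual := fun (χ : E n → ℝ) (hχ : IsTest χ) => hu.duality hmu hlam ht hχ N
  set a := freq mu
  set b := freq (lam + 2 * mu)
  have hcont := continuousOn_waveHat ha hb h₀ h₁ N t
  have hU : IsOpen ({0}ᶜ : Set (E n)) := isOpen_compl_singleton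
  have hli : LocallyIntegrableOn (fun ξ => fhat (u t N) ξ - waveHat a b f₀ f₁ N t ξ)
      ({0}ᶜ : Set (E n)) volume :=
    (((Lp.memLp (fhat (u t N))).locallyIntegrable (by norm_num)).locallyIntegrableOn _).sub
      (hcont.locallyIntegrableOn hU.measurableSet)
  have := hU.ae_eq_zero_of_integral_contDiff_smul_eq_zero hli ?_
  · have h0 : ∀ᵐ ξ : E n, ξ ≠ 0 := by
      have : Nontrivial (E n) := inferInstance
      simp [ae_iff]
    filter_upwards [this, h0] with ξ h h' using sub_eq_zero.1 (h h')
  intro χ hχs hχc hχU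
  have hχ : IsTest χ := ⟨hχs, hχc, fun h => hχU h rfl⟩
  have hz := isTest_zero (n := n)
  have m1 : ∀ k, MemLp (osc a b t (fun _ => 0) (ampT a χ N k) (fun _ => 0) (ampL b χ N k) 0) 2 :=
    fun k => (hz.osc (hχ.ampT ha N k) hz (hχ.ampL hb N k) 0).memLp
  have m0 : ∀ k, MemLp (osc a b t (fun ξ => ampT a χ N k ξ * (-a * ‖ξ‖)) (fun ξ => 0 * (a * ‖ξ‖))
      (fun ξ => ampL b χ N k ξ * (-b * ‖ξ‖)) (fun ξ => 0 * (b * ‖ξ‖)) 0) 2 := fun k =>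
    (((hχ.ampT ha N k).mul_norm _).osc (hz.mul_norm _) ((hχ.ampL hb N k).mul_norm _)
      (hz.mul_norm _) 0).memLp
  have hformula : ∫ ξ, (χ ξ : ℂ) * fhat (u t N) ξ = ∫ ξ, (χ ξ : ℂ) * waveHat a b f₀ f₁ N t ξ := by
    rw [hdual χ hχ, Finset.sum_congr rfl fun k _ => (integral_sub (integrable_mul_Lp (m1 k) _)
      (integrable_mul_Lp (m0 k) _)).symm, ← integral_finsetSum]
    swap
    · exact fun k _ => (integrable_mul_Lp (m1 k) (fhat (f₁ k))).sub
        (integrable_mul_Lp (m0 k) (fhat (f₀ k)))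
    refine integral_congr_ae ?_
    have e0 : ∀ᵐ ξ, ∀ k, fhat (f₀ k) ξ = ft (f₀ k) ξ :=
      ae_all_iff.2 fun k => ElasticWave.fhat_ae_eq (h₀ k)
    have e1 : ∀ᵐ ξ, ∀ k, fhat (f₁ k) ξ = ft (f₁ k) ξ :=
      ae_all_iff.2 fun k => ElasticWave.fhat_ae_eq (h₁ k)
    filter_upwards [e0, e1] with ξ e0 e1
    rcases eq_or_ne ξ 0 with rfl | hξ
    · have : χ 0 = 0 := image_eq_zero_of_notMem_tsupport hχ.zero_notMem
      simp [osc, ampT, ampL, this]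
    have hr : (‖ξ‖ : ℂ) ≠ 0 := by exact_mod_cast norm_ne_zero_iff.2 hξ
    have ha' : (a : ℂ) ≠ 0 := by exact_mod_cast ha
    have hb' : (b : ℂ) ≠ 0 := by exact_mod_cast hb
    have e3 : ∀ g : Fin n → L2 n, transv g N ξ =
        ∑ k, ((((if k = N then 1 else 0) - proj N k ξ : ℝ) : ℂ) * ft (g k) ξ) := by
      intro g
      simp [transv, longit, sub_mul, Finset.sum_sub_distrib, apply_ite]
    rw [waveHat, e3 f₀, e3 f₁, longit, longit]
    simp only [Finset.mul_sum, ← Finset.sum_add_distrib]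
    refine Finset.sum_congr rfl fun k _ => ?_
    rw [e0, e1]
    simp only [osc, ampT, ampL, sub_zero]
    generalize (if k = N then (1 : ℝ) else 0) = δ
    push_cast
    field_simp
    ring
  have i1 : Integrable (fun ξ => (χ ξ : ℂ) * fhat (u t N) ξ) := integrable_mul_Lp hχ.memLp _
  have i2 : Integrable (fun ξ => (χ ξ : ℂ) * waveHat a b f₀ f₁ N t ξ) := by
    refine Continuous.integrable_of_hasCompactSupport ?_ ?_
    · refine continuous_iff_continuousAt.2 fun ξ => ?_
      by_cases hξ : ξ ∈ tsupport χ
      · exact (Complex.continuous_ofReal.comp hχs.continuous).continuousAt.mul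
          (hcont.continuousAt (hU.mem_nhds (hχU hξ)))
      · have h0 : (fun ξ => (χ ξ : ℂ) * waveHat a b f₀ f₁ N t ξ) =ᶠ[𝓝 ξ] fun _ => 0 := by
          filter_upwards [notMem_tsupport_iff_eventuallyEq.1 hξ] with x hx
          simp [hx]
        exact continuousAt_const.congr h0.symm
    · exact HasCompactSupport.mul_right
        (hχc.comp_left (g := fun t : ℝ => (t : ℂ)) Complex.ofReal_zero)
  calc ∫ x, χ x • (fhat (u t N) x - waveHat a b f₀ f₁ N t x)
      = ∫ x, ((χ x : ℂ) * fhat (u t N) x - (χ x : ℂ) * waveHat a b f₀ f₁ N t x) := by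
        refine integral_congr_ae (ae_of_all _ fun x => ?_)
        simp only [Complex.real_smul]; ring
    _ = 0 := by rw [integral_sub i1 i2, hformula, sub_self]

/-! ### The Riemann-Lebesgue lemma for radial oscillations -/

/-- Integration in polar coordinates. -/
lemma integral_eq_integral_polar {V F : Type*} [NormedAddCommGroup V] [NormedSpace ℝ V]
    [FiniteDimensional ℝ V] [Nontrivial V] [MeasurableSpace V] [BorelSpace V] (μ : Measure V)
    [μ.IsAddHaarMeasure] [NormedAddCommGroup F] [NormedSpace ℝ F] {f : V → F}
    (hf : Integrable f μ) :
    ∫ x, f x ∂μ = ∫ r in Ioi (0 : ℝ), r ^ (Module.finrank ℝ V - 1) •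
      ∫ s : Metric.sphere (0 : V) 1, f (r • (s : V)) ∂μ.toSphere := by
  have hmp := (μ.measurePreserving_homeomorphUnitSphereProd).symm
    (homeomorphUnitSphereProd V).toMeasurableEquiv
  have hemb := (homeomorphUnitSphereProd V).symm.measurableEmbedding
  have hf' : Integrable (fun x : ({(0)}ᶜ : Set V) => f x) (μ.comap (↑)) := by
    exact (integrableOn_iff_comap_subtypeVal (measurableSet_singleton _).compl).1 hf.integrableOn
  have hint : Integrable (fun p : Metric.sphere (0 : V) 1 × Ioi (0 : ℝ) => f (p.2.1 • p.1.1))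
      (μ.toSphere.prod (.volumeIoiPow (Module.finrank ℝ V - 1))) := by
    have := (hmp.integrable_comp_emb hemb (g := fun x : ({(0)}ᶜ : Set V) => f x)).2 hf'
    exact this
  calc ∫ x, f x ∂μ = ∫ x : ({(0)}ᶜ : Set V), f x ∂(μ.comap (↑)) := by
        rw [integral_subtype_comap (measurableSet_singleton _).compl fun x ↦ f x,
          restrict_compl_singleton]
    _ = ∫ p : Metric.sphere (0 : V) 1 × Ioi (0 : ℝ), f (p.2.1 • p.1.1)
          ∂(μ.toSphere.prod (.volumeIoiPow (Module.finrank ℝ V - 1))) :=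
        (hmp.integral_comp hemb (fun x : ({(0)}ᶜ : Set V) => f x)).symm
    _ = ∫ r : Ioi (0 : ℝ), (∫ s : Metric.sphere (0 : V) 1, f (r.1 • (s : V)) ∂μ.toSphere)
          ∂(.volumeIoiPow (Module.finrank ℝ V - 1)) := integral_prod_symm _ hint
    _ = _ := by
      simp only [Measure.volumeIoiPow, ENNReal.ofReal]
      rw [integral_withDensity_eq_integral_smul, integral_subtype_comap measurableSet_Ioi
        fun a ↦ Real.toNNReal (a ^ (Module.finrank ℝ V - 1)) •
          ∫ s : Metric.sphere (0 : V) 1, f (a • (s : V)) ∂μ.toSphere,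
        setIntegral_congr_fun measurableSet_Ioi fun x hx ↦ ?_]
      · rw [NNReal.smul_def, Real.coe_toNNReal _ (pow_nonneg hx.out.le _)]
      · exact (measurable_subtype_coe.pow_const _).real_toNNReal

/-- The Riemann-Lebesgue lemma for the phase function `|x|`. -/
lemma tendsto_integral_exp_norm_smul {V : Type*} [NormedAddCommGroup V] [NormedSpace ℝ V]
    [FiniteDimensional ℝ V] [Nontrivial V] [MeasurableSpace V] [BorelSpace V] (μ : Measure V)
    [μ.IsAddHaarMeasure] {h : V → ℂ} (hh : Integrable h μ) :
    Tendsto (fun w : ℝ => ∫ x, Complex.exp (Complex.I * (w * ‖x‖ : ℝ)) * h x ∂μ)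
      (cocompact ℝ) (𝓝 0) := by
  -- the factor comes from `𝐞 (-y) = exp (-2πi y)`
  have key : ∀ w : ℝ, ∫ x, Complex.exp (Complex.I * (w * ‖x‖ : ℝ)) * h x ∂μ =
      ∫ r : ℝ, Real.fourierChar (-(r * (-(2 * Real.pi)⁻¹ * w))) • (Ioi (0 : ℝ)).indicator
        (fun r => r ^ (Module.finrank ℝ V - 1) •
          ∫ s : Metric.sphere (0 : V) 1, h (r • (s : V)) ∂μ.toSphere) r := by
    intro w
    have hint : Integrable (fun x => Complex.exp (Complex.I * (w * ‖x‖ : ℝ)) * h x) μ := by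
      refine hh.mono (Continuous.aestronglyMeasurable (by fun_prop) |>.mul
        hh.aestronglyMeasurable) (ae_of_all _ fun x => ?_)
      rw [norm_mul, Complex.norm_exp_I_mul_ofReal, one_mul]
    rw [integral_eq_integral_polar μ hint, ← integral_indicator measurableSet_Ioi]
    refine integral_congr_ae (ae_of_all _ fun r => ?_)
    dsimp only
    by_cases hr : r ∈ Ioi (0 : ℝ)
    · rw [indicator_of_mem hr, indicator_of_mem hr, Circle.smul_def, Real.fourierChar_apply,
        smul_comm]
      congr 1
      rw [smul_eq_mul, ← integral_const_mul]
      refine integral_congr_ae (ae_of_all _ fun s => ?_)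
      have hn : ‖r • (s : V)‖ = r := by
        rw [norm_smul, mem_sphere_zero_iff_norm.1 s.2, mul_one, Real.norm_of_nonneg (le_of_lt hr)]
      dsimp only
      rw [hn]
      congr 2
      have := Real.pi_ne_zero
      push_cast
      field_simp
    · rw [indicator_of_notMem hr, indicator_of_notMem hr, smul_zero]
  simp only [key]
  refine (Real.tendsto_integral_exp_smul_cocompact _).comp ?_
  exact (Homeomorph.mulLeft₀ (-(2 * Real.pi)⁻¹ : ℝ)
    (by simp [Real.pi_ne_zero])).isClosedEmbedding.tendsto_cocompact

/-- Oscillations `e^{i θ_j t |x|}` with distinct frequencies become orthogonal as `t → ∞`. -/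
lemma tendsto_integral_norm_sq_sum {V ι : Type*} [NormedAddCommGroup V] [NormedSpace ℝ V]
    [FiniteDimensional ℝ V] [Nontrivial V] [MeasurableSpace V] [BorelSpace V] (μ : Measure V)
    [μ.IsAddHaarMeasure] [Fintype ι] {θ : ι → ℝ} (hθ : Function.Injective θ) {Z : ι → V → ℂ}
    (hZ : ∀ j, MemLp (Z j) 2 μ) :
    Tendsto (fun t : ℝ => ∫ x, ‖∑ j, Complex.exp (Complex.I * (θ j * t * ‖x‖ : ℝ)) * Z j x‖ ^ 2 ∂μ)
      atTop (𝓝 (∑ j, ∫ x, ‖Z j x‖ ^ 2 ∂μ)) := by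
  classical
  have hprod : ∀ j l, Integrable (fun x => (starRingEnd ℂ) (Z j x) * Z l x) μ := fun j l =>
    MemLp.integrable_mul (p := 2) (q := 2) (hZ j).star (hZ l)
  have hprod' : ∀ j l (t : ℝ), Integrable (fun x => Complex.exp
      (Complex.I * ((θ l - θ j) * t * ‖x‖ : ℝ)) * ((starRingEnd ℂ) (Z j x) * Z l x)) μ := by
    intro j l t
    refine (hprod j l).mono (Continuous.aestronglyMeasurable (by fun_prop) |>.mul
      (hprod j l).aestronglyMeasurable) (ae_of_all _ fun x => ?_)
    rw [norm_mul, Complex.norm_exp_I_mul_ofReal, one_mul]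
  have hexp : ∀ t : ℝ, ((∫ x, ‖∑ j, Complex.exp (Complex.I * (θ j * t * ‖x‖ : ℝ)) * Z j x‖ ^ 2 ∂μ
      : ℝ) : ℂ) = ∑ j, ∑ l, ∫ x, Complex.exp (Complex.I * ((θ l - θ j) * t * ‖x‖ : ℝ)) *
        ((starRingEnd ℂ) (Z j x) * Z l x) ∂μ := by
    intro t
    have : ∀ j, ∑ l, ∫ x, Complex.exp (Complex.I * ((θ l - θ j) * t * ‖x‖ : ℝ)) *
        ((starRingEnd ℂ) (Z j x) * Z l x) ∂μ = ∫ x, ∑ l, Complex.exp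
        (Complex.I * ((θ l - θ j) * t * ‖x‖ : ℝ)) * ((starRingEnd ℂ) (Z j x) * Z l x) ∂μ :=
      fun j => (integral_finsetSum _ fun l _ => hprod' j l t).symm
    rw [Finset.sum_congr rfl fun j _ => this j, ← integral_finsetSum _ fun j _ =>
      integrable_finsetSum _ fun l _ => hprod' j l t, ← integral_complex_ofReal]
    refine integral_congr_ae (ae_of_all _ fun x => ?_)
    dsimp only
    rw [← Complex.normSq_eq_norm_sq]
    rw [Complex.normSq_eq_conj_mul_self, map_sum, Finset.sum_mul_sum]
    refine Finset.sum_congr rfl fun j _ => Finset.sum_congr rfl fun l _ => ?_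
    rw [map_mul, ← Complex.exp_conj, map_mul, Complex.conj_I, Complex.conj_ofReal]
    have : Complex.exp (Complex.I * ((θ l - θ j) * t * ‖x‖ : ℝ)) =
        Complex.exp (-Complex.I * (θ j * t * ‖x‖ : ℝ)) *
          Complex.exp (Complex.I * (θ l * t * ‖x‖ : ℝ)) := by
      rw [← Complex.exp_add]
      congr 1
      push_cast
      ring
    rw [this]
    ring
  have hlim : Tendsto (fun t : ℝ => ∑ j, ∑ l, ∫ x, Complex.exp
      (Complex.I * ((θ l - θ j) * t * ‖x‖ : ℝ)) * ((starRingEnd ℂ) (Z j x) * Z l x) ∂μ) atTop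
      (𝓝 (∑ j, ∑ l, if l = j then ∫ x, (starRingEnd ℂ) (Z j x) * Z l x ∂μ else 0)) := by
    refine tendsto_finsetSum _ fun j _ => tendsto_finsetSum _ fun l _ => ?_
    split_ifs with hjl
    · subst hjl
      simp
    · have hne : θ l - θ j ≠ 0 := sub_ne_zero.2 fun h => hjl (hθ h)
      refine (tendsto_integral_exp_norm_smul μ (hprod j l)).comp ?_
      have h1 : Tendsto (fun t : ℝ => (θ l - θ j) * t) (cocompact ℝ) (cocompact ℝ) :=
        (Homeomorph.mulLeft₀ _ hne).isClosedEmbedding.tendsto_cocompact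
      exact h1.mono_left atTop_le_cocompact
  have hsum : (∑ j, ∑ l, if l = j then ∫ x, (starRingEnd ℂ) (Z j x) * Z l x ∂μ else 0) =
      ((∑ j, ∫ x, ‖Z j x‖ ^ 2 ∂μ : ℝ) : ℂ) := by
    rw [Complex.ofReal_sum]
    refine Finset.sum_congr rfl fun j _ => ?_
    rw [Finset.sum_ite_eq' Finset.univ j, if_pos (Finset.mem_univ _), ← integral_complex_ofReal]
    refine integral_congr_ae (ae_of_all _ fun x => ?_)
    dsimp only
    rw [← Complex.normSq_eq_norm_sq]
    exact Complex.normSq_eq_conj_mul_self.symm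
  rw [hsum] at hlim
  simp only [← hexp] at hlim
  exact (Complex.continuous_re.tendsto _).comp hlim

/-! ### Persistence of oscillations -/

/-- A sum of oscillations with the frequencies `a |ξ|` and `b |ξ|` does not tend to zero in `L²`
on a compact set unless its amplitudes vanish. -/
lemma exists_le_setIntegral_norm_sq_osc {n : ℕ} [Nonempty (Fin n)] {a b : ℝ} (ha : 0 < a)
    (hb : 0 < b) (hab : a ≠ b) {X : Fin 4 → E n → ℂ} {K : Set (E n)} (hK : IsCompact K)
    (hX : ∀ i, ContinuousOn (X i) K) {ξ₀ : E n} (hξ₀ : ξ₀ ∈ interior K) {i₀ : Fin 4}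
    (hne : X i₀ ξ₀ ≠ 0) :
    ∃ c : ℝ, 0 < c ∧ ∃ T : ℝ, 0 < T ∧ ∀ t : ℝ, T ≤ t →
      c ≤ ∫ ξ in K, ‖Real.cos (a * ‖ξ‖ * t) * X 0 ξ + Real.cos (b * ‖ξ‖ * t) * X 1 ξ
        + Real.sin (a * ‖ξ‖ * t) * X 2 ξ + Real.sin (b * ‖ξ‖ * t) * X 3 ξ‖ ^ 2 := by
  -- sines and cosines are rewritten as exponentials with the frequencies `±a`, `±b`
  set θ : Fin 4 → ℝ := ![a, b, -a, -b] with hθdef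
  set Y : Fin 4 → E n → ℂ := ![fun ξ => (X 0 ξ - Complex.I * X 2 ξ) / 2,
    fun ξ => (X 1 ξ - Complex.I * X 3 ξ) / 2, fun ξ => (X 0 ξ + Complex.I * X 2 ξ) / 2,
    fun ξ => (X 1 ξ + Complex.I * X 3 ξ) / 2] with hY
  have hθ : Function.Injective θ := by
    intro i j hij
    fin_cases i <;> fin_cases j <;> simp [θ] at hij ⊢ <;>
      first | exact hab hij | exact hab hij.symm | linarith
  have hYc : ∀ i, ContinuousOn (Y i) K := by
    intro i
    fin_cases i
    · exact ((hX 0).sub (continuousOn_const.mul (hX 2))).div_const 2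
    · exact ((hX 1).sub (continuousOn_const.mul (hX 3))).div_const 2
    · exact ((hX 0).add (continuousOn_const.mul (hX 2))).div_const 2
    · exact ((hX 1).add (continuousOn_const.mul (hX 3))).div_const 2
  set Z : Fin 4 → E n → ℂ := fun i => K.indicator (Y i) with hZdef
  have hZ : ∀ i, MemLp (Z i) 2 volume := by
    intro i
    obtain ⟨C, hC⟩ := hK.exists_bound_of_continuousOn (hYc i)
    rw [memLp_indicator_iff_restrict hK.measurableSet]
    have : IsFiniteMeasure (volume.restrict K) := ⟨by simpa using hK.measure_lt_top⟩
    exact MemLp.of_bound ((hYc i).aestronglyMeasurable hK.measurableSet) C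
      ((ae_restrict_iff' hK.measurableSet).2 (ae_of_all _ hC))
  have hlim := tendsto_integral_norm_sq_sum volume hθ hZ
  have hint : ∀ i, Integrable (fun ξ => ‖Z i ξ‖ ^ 2) := fun i =>
    (hZ i).integrable_norm_pow two_ne_zero
  have hpos : 0 < ∑ i, ∫ ξ, ‖Z i ξ‖ ^ 2 := by
    by_contra hcon
    have hz : ∀ i, ∫ ξ, ‖Z i ξ‖ ^ 2 = 0 := by
      have h0 : ∀ i ∈ (Finset.univ : Finset (Fin 4)), 0 ≤ ∫ ξ, ‖Z i ξ‖ ^ 2 := fun i _ =>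
        integral_nonneg fun ξ => by positivity
      have := (Finset.sum_eq_zero_iff_of_nonneg h0).1
        (le_antisymm (not_lt.1 hcon) (Finset.sum_nonneg h0))
      exact fun i => this i (Finset.mem_univ i)
    have hYz : ∀ i, Y i ξ₀ = 0 := by
      intro i
      have h1 := (integral_eq_zero_iff_of_nonneg (fun ξ => by positivity) (hint i)).1 (hz i)
      have h2 : Y i =ᵐ[volume.restrict (interior K)] fun _ => 0 := by
        rw [EventuallyEq, ae_restrict_iff' isOpen_interior.measurableSet]
        filter_upwards [h1] with ξ h hξ
        have : Z i ξ = 0 := by simpa using h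
        simp only [hZdef] at this
        rwa [indicator_of_mem (interior_subset hξ)] at this
      exact Measure.eqOn_open_of_ae_eq h2 isOpen_interior ((hYc i).mono interior_subset)
        continuousOn_const hξ₀
    have y0 : (X 0 ξ₀ - Complex.I * X 2 ξ₀) / 2 = 0 := hYz 0
    have y1 : (X 1 ξ₀ - Complex.I * X 3 ξ₀) / 2 = 0 := hYz 1
    have y2 : (X 0 ξ₀ + Complex.I * X 2 ξ₀) / 2 = 0 := hYz 2
    have y3 : (X 1 ξ₀ + Complex.I * X 3 ξ₀) / 2 = 0 := hYz 3
    apply hne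
    fin_cases i₀
    · change X 0 ξ₀ = 0
      linear_combination y0 + y2
    · change X 1 ξ₀ = 0
      linear_combination y1 + y3
    · change X 2 ξ₀ = 0
      linear_combination Complex.I * (y0 - y2) + X 2 ξ₀ * Complex.I_sq
    · change X 3 ξ₀ = 0
      linear_combination Complex.I * (y1 - y3) + X 3 ξ₀ * Complex.I_sq
  obtain ⟨T, hT⟩ := eventually_atTop.1 (hlim.eventually (lt_mem_nhds (half_lt_self hpos)))
  refine ⟨_, half_pos hpos, max T 1, by positivity, fun t ht => ?_⟩
  refine (hT t ((le_max_left _ _).trans ht)).le.trans (le_of_eq ?_)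
  rw [← integral_indicator hK.measurableSet]
  refine integral_congr_ae (ae_of_all _ fun ξ => ?_)
  dsimp only
  by_cases hξ : ξ ∈ K
  · rw [indicator_of_mem hξ]
    congr 2
    have hexp : ∀ x : ℝ, Complex.exp (Complex.I * x) = Real.cos x + Complex.I * Real.sin x :=
      fun x => by rw [mul_comm, Complex.exp_mul_I]; push_cast; ring
    simp only [hZdef, indicator_of_mem hξ, Fin.sum_univ_four, hexp]
    have e0 : θ 0 * t * ‖ξ‖ = a * ‖ξ‖ * t := by simp only [θ]; simp; ring
    have e1 : θ 1 * t * ‖ξ‖ = b * ‖ξ‖ * t := by simp only [θ]; simp; ring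
    have e2 : θ 2 * t * ‖ξ‖ = -(a * ‖ξ‖ * t) := by simp only [θ]; simp; ring
    have e3 : θ 3 * t * ‖ξ‖ = -(b * ‖ξ‖ * t) := by simp only [θ]; simp; ring
    rw [e0, e1, e2, e3, Real.cos_neg, Real.sin_neg, Real.cos_neg, Real.sin_neg]
    have y0 : Y 0 ξ = (X 0 ξ - Complex.I * X 2 ξ) / 2 := rfl
    have y1 : Y 1 ξ = (X 1 ξ - Complex.I * X 3 ξ) / 2 := rfl
    have y2 : Y 2 ξ = (X 0 ξ + Complex.I * X 2 ξ) / 2 := rfl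
    have y3 : Y 3 ξ = (X 1 ξ + Complex.I * X 3 ξ) / 2 := rfl
    rw [y0, y1, y2, y3]
    generalize Real.cos (a * ‖ξ‖ * t) = ca
    generalize Real.sin (a * ‖ξ‖ * t) = sa
    generalize Real.cos (b * ‖ξ‖ * t) = cb
    generalize Real.sin (b * ‖ξ‖ * t) = sb
    push_cast
    linear_combination (-(sa : ℂ) * X 2 ξ - sb * X 3 ξ) * Complex.I_sq
  · simp [hZdef, hξ]

/-! ### First moments as derivatives of the Fourier transform -/

/-- Along a line through the origin, the derivative of the Fourier transform at zero is `2πi` times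
a combination of the first moments, which carry a minus sign by definition. -/
lemma hasDerivAt_ft_line {n : ℕ} {f : Fin n → L2 n} (hf : ∀ k, MemL11 (f k)) (k : Fin n)
    (η : E n) :
    HasDerivAt (fun s : ℝ => ft (f k) (s • η))
      (2 * Real.pi * Complex.I * ((∑ l, moment1 f k l * η l : ℝ) : ℂ)) 0 := by
  have hi : Integrable (fun x => ((f k x : ℝ) : ℂ)) := (hf k).integrable.ofReal
  have hi1 : Integrable (fun x => ‖x‖ * ‖((f k x : ℝ) : ℂ)‖) := by
    simpa using (hf k).integrable_norm_mul
  have hcoord : ∀ l, Integrable (fun x : E n => x l * f k x) := by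
    intro l
    refine (hf k).integrable_norm_mul.mono (((EuclideanSpace.proj (𝕜 := ℝ) l).continuous
      |>.aestronglyMeasurable).mul (Lp.aestronglyMeasurable (f k))) (ae_of_all _ fun x => ?_)
    rw [norm_mul, norm_mul, norm_norm, norm_norm]
    exact mul_le_mul_of_nonneg_right (PiLp.norm_apply_le x l) (norm_nonneg _)
  have h := Real.hasFDerivAt_fourier hi hi1 ((0 : ℝ) • η)
  have hl : HasDerivAt (fun s : ℝ => s • η) η 0 := by
    simpa using (hasDerivAt_id (0 : ℝ)).smul_const η
  refine (h.comp_hasDerivAt (0 : ℝ) hl).congr_deriv ?_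
  rw [zero_smul, Real.fourier_eq]
  simp only [inner_zero_right, neg_zero, AddChar.map_zero_eq_one, one_smul]
  rw [ContinuousLinearMap.integral_apply]
  swap
  · refine hi1.const_mul (2 * Real.pi * ‖innerSL ℝ (E := E n)‖) |>.mono
      hi.aestronglyMeasurable.fourierSMulRight (ae_of_all _ fun x => ?_)
    refine (VectorFourier.norm_fourierSMulRight_le _ _ _).trans (le_of_eq ?_)
    rw [Real.norm_of_nonneg (by positivity)]
    ring
  calc ∫ x, VectorFourier.fourierSMulRight (innerSL ℝ) (fun x => ((f k x : ℝ) : ℂ)) x η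
      = ∫ x, (-(2 * Real.pi * Complex.I)) * ((∑ l, x l * f k x * η l : ℝ) : ℂ) := by
        refine integral_congr_ae (ae_of_all _ fun x => ?_)
        dsimp only
        rw [VectorFourier.fourierSMulRight_apply]
        have : innerSL ℝ x η = ∑ l, x l * η l := by
          rw [innerSL_apply_apply, PiLp.inner_apply]
          exact Finset.sum_congr rfl fun l _ => by simp [mul_comm]
        rw [this, smul_eq_mul, Complex.real_smul, ← Complex.ofReal_mul, Finset.sum_mul]
        congr 3
        funext l
        ring
    _ = _ := by
        rw [integral_const_mul, integral_complex_ofReal, integral_finsetSum _ fun l _ =>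
          (hcoord l).mul_const _]
        simp only [integral_mul_const, moment1, neg_mul, Finset.sum_neg_distrib]
        push_cast
        ring

/-- A quadratic form that vanishes off a coordinate hyperplane is zero. -/
lemma add_transpose_eq_zero_of_quadratic {n : ℕ} {p : Matrix (Fin n) (Fin n) ℝ} {N : Fin n}
    (h : ∀ η : Fin n → ℝ, η N ≠ 0 → η ⬝ᵥ p.mulVec η = 0) (k l : Fin n) : p k l + p l k = 0 := by
  have hq : ∀ η : Fin n → ℝ, η ⬝ᵥ p.mulVec η = 0 := by
    intro η
    by_cases hη : η N = 0
    · have h1 := h (η + Pi.single N 1) (by simp [hη])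
      have h2 := h (η - Pi.single N 1) (by simp [hη])
      have h3 := h (Pi.single N 1) (by simp)
      simp only [Matrix.mulVec_add, Matrix.mulVec_sub, add_dotProduct, sub_dotProduct,
        dotProduct_add, dotProduct_sub] at h1 h2
      linarith
    · exact h η hη
  have h1 := hq (Pi.single k 1 + Pi.single l 1)
  have h2 := hq (Pi.single k 1)
  have h3 := hq (Pi.single l 1)
  simp only [Matrix.mulVec_add, add_dotProduct, dotProduct_add] at h1
  have h4 : (Pi.single k 1 : Fin n → ℝ) ⬝ᵥ p.mulVec (Pi.single l 1)
      + (Pi.single l 1 : Fin n → ℝ) ⬝ᵥ p.mulVec (Pi.single k 1) = 0 := by linarith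
  simpa using h4

/-- The combinations of first moments in `absPP` are among those that must vanish when both the
transversal and the longitudinal part of the `N`-th component vanish identically: in that case
`f̂_N = 0` and `ξ · f̂ = 0`. -/
lemma exists_transv_or_longit_ne_zero {n : ℕ} {f : Fin n → L2 n} (hf : ∀ k, MemL11 (f k))
    {N : Fin n} (h : absPP f N ≠ 0) :
    ∃ ξ : E n, ξ ≠ 0 ∧ (transv f N ξ ≠ 0 ∨ longit f N ξ ≠ 0) := by
  by_contra! hcon
  have : Nonempty (Fin n) := ⟨N⟩
  apply h
  have hc : ∀ k, Continuous (ft (f k)) := fun k => continuous_ft (hf k).integrable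
  have hπ : (2 * Real.pi * Complex.I : ℂ) ≠ 0 := by simp [Real.pi_ne_zero]
  -- the `N`-th component of the Fourier transform vanishes
  have hN : ∀ ξ, ft (f N) ξ = 0 := by
    have : EqOn (ft (f N)) (fun _ => 0) {0}ᶜ := fun ξ hξ => by
      have h1 := hcon ξ hξ
      have h2 := h1.1
      rw [transv, h1.2, sub_zero] at h2
      exact h2
    exact congrFun ((hc N).ext_on (dense_compl_singleton (0 : E n)) continuous_const this)
  have hpN : ∀ l, moment1 f N l = 0 := by
    intro l
    have h1 := hasDerivAt_ft_line hf N (unitVec l)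
    simp only [hN] at h1
    have h2 := h1.unique (hasDerivAt_const _ _)
    simpa [unitVec, PiLp.single_apply, hπ] using h2
  -- the divergence vanishes, which is a condition on the symmetric part of the first moments
  have hquad : ∀ η : Fin n → ℝ, η N ≠ 0 →
      η ⬝ᵥ (Matrix.of (moment1 f)).mulVec η = 0 := by
    intro η hη
    set v : E n := WithLp.toLp 2 η
    have hv : ∀ k, v k = η k := fun k => rfl
    have hQ : ∀ s : ℝ, ∑ k, (v k : ℂ) * ft (f k) (s • v) = 0 := by
      have hoff : EqOn (fun s : ℝ => ∑ k, (v k : ℂ) * ft (f k) (s • v)) (fun _ => 0) {0}ᶜ := by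
        intro s (hs : s ≠ 0)
        have hsv : s • v ≠ 0 := fun h0 => by
          have := congrArg (fun w : E n => w N) h0
          simp [hs, hv, hη] at this
        have h1 := (hcon _ hsv).2
        have hr : ‖s • v‖ ≠ 0 := norm_ne_zero_iff.2 hsv
        have h2 : longit f N (s • v) =
            ((s ^ 2 * v N / ‖s • v‖ ^ 2 : ℝ) : ℂ) * ∑ k, (v k : ℂ) * ft (f k) (s • v) := by
          rw [longit, Finset.mul_sum]
          refine Finset.sum_congr rfl fun k _ => ?_
          simp only [proj, PiLp.smul_apply, smul_eq_mul]
          push_cast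
          ring
        rw [h2] at h1
        refine (mul_eq_zero.1 h1).resolve_left ?_
        exact_mod_cast div_ne_zero (mul_ne_zero (pow_ne_zero 2 hs) hη) (pow_ne_zero 2 hr)
      have hcont : Continuous (fun s : ℝ => ∑ k, (v k : ℂ) * ft (f k) (s • v)) :=
        continuous_finsetSum _ fun k _ => continuous_const.mul
          ((hc k).comp (continuous_id.smul continuous_const))
      exact congrFun (hcont.ext_on (dense_compl_singleton (0 : ℝ)) continuous_const hoff)
    have hd : HasDerivAt (fun s : ℝ => ∑ k, (v k : ℂ) * ft (f k) (s • v))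
        (∑ k, (v k : ℂ) * (2 * Real.pi * Complex.I * ((∑ l, moment1 f k l * v l : ℝ) : ℂ))) 0 :=
      HasDerivAt.fun_sum fun k _ => (hasDerivAt_ft_line hf k v).const_mul _
    simp only [hQ] at hd
    have h0 := hd.unique (hasDerivAt_const _ _)
    have h1 : (2 * Real.pi * Complex.I : ℂ) * ((∑ k, v k * ∑ l, moment1 f k l * v l : ℝ) : ℂ)
        = 0 := by
      rw [← h0, Complex.ofReal_sum, Finset.mul_sum]
      refine Finset.sum_congr rfl fun k _ => ?_
      push_cast
      ring
    have h2 := (mul_eq_zero.1 h1).resolve_left hπ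
    exact_mod_cast h2
  have hsymm := add_transpose_eq_zero_of_quadratic hquad
  simp only [Matrix.of_apply] at hsymm
  have hkN : ∀ k, moment1 f k N = 0 := fun k => by
    have := hsymm k N
    rwa [hpN k, add_zero] at this
  have hkk : ∀ k, moment1 f k k = 0 := fun k => by linarith [hsymm k k]
  simp [absPP, absP, hpN, hkN, hkk, hsymm]

/-! ### The norm of the solution -/

lemma integrable_norm_sq_Lp {n : ℕ} (f : Lp ℂ 2 (volume : Measure (E n))) :
    Integrable (fun ξ => ‖f ξ‖ ^ 2) :=
  (Lp.memLp f).integrable_norm_pow two_ne_zero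

lemma norm_sq_eq_integral {n : ℕ} (f : Lp ℂ 2 (volume : Measure (E n))) :
    ‖f‖ ^ 2 = ∫ ξ, ‖f ξ‖ ^ 2 := by
  have h : ((‖f‖ ^ 2 : ℝ) : ℂ) = ((∫ ξ, ‖f ξ‖ ^ 2 : ℝ) : ℂ) := by
    rw [← integral_complex_ofReal]
    have := inner_self_eq_norm_sq_to_K (𝕜 := ℂ) f
    push_cast
    refine this.symm.trans ?_
    rw [L2.inner_def]
    refine integral_congr_ae (ae_of_all _ fun ξ => ?_)
    exact (inner_self_eq_norm_sq_to_K (𝕜 := ℂ) (f ξ))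
  exact_mod_cast h

lemma integrable_norm_ft_sq {n : ℕ} {f : L2 n} (hf : Integrable f) :
    Integrable (fun ξ => ‖ft f ξ‖ ^ 2) := by
  refine (integrable_norm_sq_Lp (fhat f)).congr ?_
  filter_upwards [fhat_ae_eq hf] with ξ hξ
  rw [hξ]

/-- Plancherel's theorem for the Fourier integral. -/
lemma integral_norm_ft_sq {n : ℕ} {f : L2 n} (hf : Integrable f) :
    ∫ ξ, ‖ft f ξ‖ ^ 2 = ‖f‖ ^ 2 := by
  rw [← norm_fhat, norm_sq_eq_integral]
  refine integral_congr_ae ?_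
  filter_upwards [fhat_ae_eq hf] with ξ hξ
  rw [hξ]

section Solution

variable {n : ℕ} {lam mu : ℝ} {f₀ f₁ : Fin n → L2 n} {u : ℝ → Fin n → L2 n}

lemma IsSolution.integrable_norm_waveHat_sq (hmu : 0 < mu) (hlam : 0 < lam + 2 * mu)
    (hd : IsData f₀ f₁) (hu : IsSolution lam mu f₀ f₁ u) {t : ℝ} (ht : 0 ≤ t) (N : Fin n) :
    Integrable (fun ξ => ‖waveHat (freq mu) (freq (lam + 2 * mu)) f₀ f₁ N t ξ‖ ^ 2) := by
  refine (integrable_norm_sq_Lp (fhat (u t N))).congr ?_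
  filter_upwards [hu.fhat_ae_eq hmu hlam (fun k => (hd.memL11_zero k).integrable)
    (fun k => (hd.memL11_one k).integrable) ht N] with ξ hξ
  rw [hξ]

lemma IsSolution.norm_sq_eq (hmu : 0 < mu) (hlam : 0 < lam + 2 * mu)
    (hd : IsData f₀ f₁) (hu : IsSolution lam mu f₀ f₁ u) {t : ℝ} (ht : 0 ≤ t) (N : Fin n) :
    ‖u t N‖ ^ 2 = ∫ ξ, ‖waveHat (freq mu) (freq (lam + 2 * mu)) f₀ f₁ N t ξ‖ ^ 2 := by
  rw [← norm_fhat, norm_sq_eq_integral]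
  refine integral_congr_ae ?_
  filter_upwards [hu.fhat_ae_eq hmu hlam (fun k => (hd.memL11_zero k).integrable)
    (fun k => (hd.memL11_one k).integrable) ht N] with ξ hξ
  rw [hξ]

lemma IsSolution.setIntegral_le_norm_sq (hmu : 0 < mu) (hlam : 0 < lam + 2 * mu)
    (hd : IsData f₀ f₁) (hu : IsSolution lam mu f₀ f₁ u) {t : ℝ} (ht : 0 ≤ t) (N : Fin n)
    (s : Set (E n)) :
    ∫ ξ in s, ‖waveHat (freq mu) (freq (lam + 2 * mu)) f₀ f₁ N t ξ‖ ^ 2 ≤ ‖u t N‖ ^ 2 := by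
  rw [hu.norm_sq_eq hmu hlam hd ht N]
  exact setIntegral_le_integral (hu.integrable_norm_waveHat_sq hmu hlam hd ht N)
    (ae_of_all _ fun ξ => by positivity)

end Solution

lemma freq_ne {lam mu : ℝ} (hmu : 0 < mu) (hlam : 0 < lam + 2 * mu) (h : lam + mu ≠ 0) :
    freq mu ≠ freq (lam + 2 * mu) := by
  intro he
  have h1 := freq_sq hmu.le
  rw [he, freq_sq hlam.le] at h1
  have hπ := Real.pi_ne_zero
  have := mul_left_cancel₀ (by positivity) h1
  exact h (by linarith)

/-- If some combination of first moments does not vanish, then the component `u_N(t)` stays away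
from zero in `L²` for large times. -/
theorem exists_le_norm_of_absPP_ne_zero {n : ℕ} {lam mu : ℝ} (hmu : 0 < mu)
    (hlam : 0 < lam + 2 * mu) (hne : lam + mu ≠ 0) {f₀ f₁ : Fin n → L2 n} {N : Fin n}
    (hd : IsData f₀ f₁) (hP : absPP f₀ N ≠ 0 ∨ absPP f₁ N ≠ 0) :
    ∃ c : ℝ, 0 < c ∧ ∃ T : ℝ, 0 < T ∧ ∀ u : ℝ → Fin n → L2 n, IsSolution lam mu f₀ f₁ u →
      ∀ t : ℝ, T ≤ t → c ≤ ‖u t N‖ := by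
  have : Nonempty (Fin n) := ⟨N⟩
  have ha := freq_pos hmu
  have hb := freq_pos hlam
  have hab := freq_ne hmu hlam hne
  have i0 := fun k => (hd.memL11_zero k).integrable
  have i1 := fun k => (hd.memL11_one k).integrable
  set X : Fin 4 → E n → ℂ := ![transv f₀ N, longit f₀ N,
    fun ξ => (((freq mu * ‖ξ‖)⁻¹ : ℝ) : ℂ) * transv f₁ N ξ,
    fun ξ => (((freq (lam + 2 * mu) * ‖ξ‖)⁻¹ : ℝ) : ℂ) * longit f₁ N ξ] with hX
  have hinv : ∀ c : ℝ, c ≠ 0 → ContinuousOn (fun ξ : E n => (((c * ‖ξ‖)⁻¹ : ℝ) : ℂ)) {0}ᶜ :=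
    fun c hc => Complex.continuous_ofReal.comp_continuousOn fun ξ hξ =>
      (contDiffAt_inv_norm hc hξ).continuousAt.continuousWithinAt
  have hXc : ∀ i, ContinuousOn (X i) {0}ᶜ := by
    intro i
    fin_cases i
    · exact continuousOn_transv i0 N
    · exact continuousOn_longit i0 N
    · exact (hinv _ ha.ne').mul (continuousOn_transv i1 N)
    · exact (hinv _ hb.ne').mul (continuousOn_longit i1 N)
  obtain ⟨ξ₀, hξ₀, i₀, hi₀⟩ : ∃ ξ₀ : E n, ξ₀ ≠ 0 ∧ ∃ i, X i ξ₀ ≠ 0 := by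
    rcases hP with hP | hP
    · obtain ⟨ξ, hξ, h | h⟩ := exists_transv_or_longit_ne_zero hd.memL11_zero hP
      · exact ⟨ξ, hξ, 0, h⟩
      · exact ⟨ξ, hξ, 1, h⟩
    · obtain ⟨ξ, hξ, h | h⟩ := exists_transv_or_longit_ne_zero hd.memL11_one hP
      · exact ⟨ξ, hξ, 2, mul_ne_zero (by
          exact_mod_cast inv_ne_zero (mul_ne_zero ha.ne' (norm_ne_zero_iff.2 hξ))) h⟩
      · exact ⟨ξ, hξ, 3, mul_ne_zero (by
          exact_mod_cast inv_ne_zero (mul_ne_zero hb.ne' (norm_ne_zero_iff.2 hξ))) h⟩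
  have hr : 0 < ‖ξ₀‖ := norm_pos_iff.2 hξ₀
  set K : Set (E n) := Metric.closedBall ξ₀ (‖ξ₀‖ / 2)
  have hK0 : K ⊆ {0}ᶜ := by
    intro ξ hξ h0
    rw [mem_singleton_iff] at h0
    subst h0
    have : dist (0 : E n) ξ₀ ≤ ‖ξ₀‖ / 2 := hξ
    rw [dist_zero_left] at this
    linarith
  have hint : ξ₀ ∈ interior K := interior_mono Metric.ball_subset_closedBall
    (by rw [Metric.isOpen_ball.interior_eq]; exact Metric.mem_ball_self (by positivity))
  obtain ⟨c, hc, T, hT, h⟩ := exists_le_setIntegral_norm_sq_osc ha hb hab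
    (isCompact_closedBall ξ₀ (‖ξ₀‖ / 2)) (fun i => (hXc i).mono hK0) hint hi₀
  refine ⟨√c, Real.sqrt_pos.2 hc, T, hT, fun u hu t ht => Real.sqrt_le_iff.2
    ⟨norm_nonneg _, (h t ht).trans ?_⟩⟩
  refine le_trans (le_of_eq ?_) (hu.setIntegral_le_norm_sq hmu hlam hd (hT.le.trans ht) N K)
  refine integral_congr_ae (ae_of_all _ fun ξ => ?_)
  dsimp only
  congr 2
  have x0 : X 0 ξ = transv f₀ N ξ := rfl
  have x1 : X 1 ξ = longit f₀ N ξ := rfl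
  have x2 : X 2 ξ = (((freq mu * ‖ξ‖)⁻¹ : ℝ) : ℂ) * transv f₁ N ξ := rfl
  have x3 : X 3 ξ = (((freq (lam + 2 * mu) * ‖ξ‖)⁻¹ : ℝ) : ℂ) * longit f₁ N ξ := rfl
  rw [x0, x1, x2, x3, waveHat]
  push_cast
  ring

/-! ### Estimates of the Fourier transform of weighted integrable functions -/

/-- The norm of `L^{1,1}`. -/
def wnorm {n : ℕ} (f : L2 n) : ℝ := ∫ x : E n, (1 + ‖x‖) * |f x|

lemma MemL11.integrable_weight {n : ℕ} {f : L2 n} (hf : MemL11 f) :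
    Integrable (fun x : E n => (1 + ‖x‖) * |f x|) := by
  refine hf.abs.congr (ae_of_all _ fun x => ?_)
  dsimp only
  rw [abs_mul, abs_of_nonneg (by positivity : (0 : ℝ) ≤ 1 + ‖x‖)]

lemma wnorm_nonneg {n : ℕ} (f : L2 n) : 0 ≤ wnorm f :=
  integral_nonneg fun x => by positivity

lemma norm11_eq {n : ℕ} (f : Fin n → L2 n) : norm11 f = ∑ k, wnorm (f k) := rfl

lemma norm_ft_le {n : ℕ} {f : L2 n} (hf : MemL11 f) (ξ : E n) : ‖ft f ξ‖ ≤ wnorm f := by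
  refine (VectorFourier.norm_fourierIntegral_le_integral_norm _ _ _ _ _).trans ?_
  refine integral_mono hf.integrable.ofReal.norm hf.integrable_weight fun x => ?_
  simp only [Complex.norm_real, Real.norm_eq_abs]
  nlinarith [norm_nonneg x, abs_nonneg (f x)]

lemma norm_ft_sub_le {n : ℕ} {f : L2 n} (hf : MemL11 f) (ξ : E n) :
    ‖ft f ξ - ((∫ x, f x : ℝ) : ℂ)‖ ≤ 2 * Real.pi * ‖ξ‖ * wnorm f := by
  have hi := hf.integrable.ofReal (𝕜 := ℂ)
  have hi' : Integrable (fun x : E n => Real.fourierChar (-inner ℝ x ξ) • ((f x : ℝ) : ℂ)) :=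
    (Real.fourierIntegral_convergent_iff ξ).2 hi
  rw [← integral_complex_ofReal, ft, Real.fourier_eq]
  have e := integral_sub hi' hi
  refine (le_of_eq (congrArg norm e.symm)).trans ((norm_integral_le_integral_norm _).trans ?_)
  rw [wnorm, ← integral_const_mul]
  refine integral_mono (hi'.sub hi).norm (hf.integrable_weight.const_mul _) fun x => ?_
  have h1 : ‖(Real.fourierChar (-inner ℝ x ξ) : ℂ) - 1‖ ≤ 2 * Real.pi * (‖x‖ * ‖ξ‖) := by
    rw [Real.fourierChar_apply, mul_comm _ Complex.I]
    refine (Real.norm_exp_I_mul_ofReal_sub_one_le).trans ?_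
    rw [Real.norm_eq_abs, abs_mul, abs_neg, abs_of_nonneg (by positivity)]
    exact mul_le_mul_of_nonneg_left (abs_real_inner_le_norm x ξ) (by positivity)
  have h2 : Real.fourierChar (-inner ℝ x ξ) • ((f x : ℝ) : ℂ) - ((f x : ℝ) : ℂ) =
      ((Real.fourierChar (-inner ℝ x ξ) : ℂ) - 1) * ((f x : ℝ) : ℂ) := by
    rw [Circle.smul_def, smul_eq_mul]; ring
  change ‖Real.fourierChar (-inner ℝ x ξ) • ((f x : ℝ) : ℂ) - ((f x : ℝ) : ℂ)‖ ≤ _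
  rw [h2, norm_mul, Complex.norm_real, Real.norm_eq_abs]
  calc ‖(Real.fourierChar (-inner ℝ x ξ) : ℂ) - 1‖ * |f x|
      ≤ 2 * Real.pi * (‖x‖ * ‖ξ‖) * |f x| := mul_le_mul_of_nonneg_right h1 (abs_nonneg _)
    _ = 2 * Real.pi * ‖ξ‖ * (‖x‖ * |f x|) := by ring
    _ ≤ 2 * Real.pi * ‖ξ‖ * ((1 + ‖x‖) * |f x|) := by
        gcongr
        linarith

lemma abs_proj_le {n : ℕ} (j k : Fin n) (ξ : E n) : |proj j k ξ| ≤ 1 := by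
  rw [proj, abs_div, abs_mul, abs_of_nonneg (by positivity : (0 : ℝ) ≤ ‖ξ‖ ^ 2), pow_two]
  refine div_le_one_of_le₀ ?_ (by positivity)
  exact mul_le_mul (PiLp.norm_apply_le ξ j) (PiLp.norm_apply_le ξ k) (abs_nonneg _)
    (norm_nonneg _)

lemma norm_sum_proj_mul_le {n : ℕ} (N : Fin n) (ξ : E n) (z : Fin n → ℂ) :
    ‖∑ k, (proj N k ξ : ℂ) * z k‖ ≤ ∑ k, ‖z k‖ := by
  refine (norm_sum_le _ _).trans (Finset.sum_le_sum fun k _ => ?_)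
  rw [norm_mul, Complex.norm_real]
  exact mul_le_of_le_one_left (norm_nonneg _) (abs_proj_le N k ξ)

lemma norm_sub_sum_proj_mul_le {n : ℕ} (N : Fin n) (ξ : E n) (z : Fin n → ℂ) :
    ‖z N - ∑ k, (proj N k ξ : ℂ) * z k‖ ≤ 2 * ∑ k, ‖z k‖ := by
  have h1 : ‖z N‖ ≤ ∑ k, ‖z k‖ :=
    Finset.single_le_sum (f := fun k => ‖z k‖) (fun k _ => norm_nonneg _) (Finset.mem_univ N)
  linarith [norm_sub_le (z N) (∑ k, (proj N k ξ : ℂ) * z k), norm_sum_proj_mul_le N ξ z]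

lemma norm_longit_le {n : ℕ} (f : Fin n → L2 n) (N : Fin n) (ξ : E n) :
    ‖longit f N ξ‖ ≤ ∑ k, ‖ft (f k) ξ‖ :=
  norm_sum_proj_mul_le N ξ fun k => ft (f k) ξ

lemma norm_transv_le {n : ℕ} (f : Fin n → L2 n) (N : Fin n) (ξ : E n) :
    ‖transv f N ξ‖ ≤ 2 * ∑ k, ‖ft (f k) ξ‖ :=
  norm_sub_sum_proj_mul_le N ξ fun k => ft (f k) ξ

/-! ### Logarithmic growth in the plane -/

/-- The ring `1/2 ≤ |ξ| < 1` in the plane. -/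
def unitRing : Set (E 2) := Metric.ball 0 1 \ Metric.ball 0 (1 / 2)

lemma measurableSet_unitRing : MeasurableSet unitRing :=
  measurableSet_ball.diff measurableSet_ball

lemma mem_unitRing {ξ : E 2} : ξ ∈ unitRing ↔ 1 / 2 ≤ ‖ξ‖ ∧ ‖ξ‖ < 1 := by
  simp [unitRing, and_comm]

/-- A family with the scaling of the squared low frequency part of a plane wave has, over the unit
disc, the same integral at time `t` as at time `t / 2` up to the contribution of the ring. -/
lemma setIntegral_ball_eq_unitRing_add {q : ℝ → E 2 → ℝ}
    (hscale : ∀ t ξ, q t ((1 / 2 : ℝ) • ξ) = 4 * q (t / 2) ξ) {t : ℝ}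
    (hq : IntegrableOn (q t) (Metric.ball 0 1)) :
    ∫ ξ in Metric.ball 0 1, q t ξ =
      (∫ ξ in unitRing, q t ξ) + ∫ ξ in Metric.ball 0 1, q (t / 2) ξ := by
  have hsub : (Metric.ball (0 : E 2) (1 / 2)) ⊆ Metric.ball 0 1 :=
    Metric.ball_subset_ball (by norm_num)
  have hU : Metric.ball (0 : E 2) 1 = unitRing ∪ Metric.ball 0 (1 / 2) := by
    rw [unitRing, sdiff_union_of_subset hsub]
  have h1 : ∫ ξ in Metric.ball (0 : E 2) 1, q t ξ =
      (∫ ξ in unitRing, q t ξ) + ∫ ξ in Metric.ball 0 (1 / 2), q t ξ := by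
    conv_lhs => rw [hU]
    exact setIntegral_union disjoint_sdiff_left measurableSet_ball
      (hq.mono_set sdiff_subset) (hq.mono_set hsub)
  rw [h1]
  congr 1
  have h2 := Measure.setIntegral_comp_smul (volume : Measure (E 2)) (q t) (R := 1 / 2)
    (Metric.ball 0 1) (by norm_num)
  rw [smul_unitBall (by norm_num : (1 / 2 : ℝ) ≠ 0)] at h2
  simp only [hscale, integral_const_mul, finrank_euclideanSpace, Fintype.card_fin] at h2
  norm_num at h2 ⊢
  linarith

/-- The number of halvings that bring `t` below `1` is at most logarithmic. -/
lemma exists_nat_le_two_pow {t : ℝ} (ht : 0 ≤ t) :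
    ∃ j : ℕ, t ≤ 2 ^ j ∧ (j : ℝ) + 1 ≤ 3 / Real.log 2 * Real.log (t + 2) := by
  have h2 : 0 < Real.log 2 := Real.log_pos one_lt_two
  have hL : Real.log 2 ≤ Real.log (t + 2) := Real.log_le_log two_pos (by linarith)
  set x := Real.log (t + 2) / Real.log 2 with hx
  have hx1 : 1 ≤ x := (one_le_div h2).2 hL
  refine ⟨⌈x⌉₊, ?_, ?_⟩
  · have : t + 2 = (2 : ℝ) ^ x := by
      rw [Real.rpow_def_of_pos two_pos, hx, mul_div_cancel₀ _ h2.ne', Real.exp_log (by linarith)]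
    calc t ≤ (2 : ℝ) ^ x := by linarith
      _ ≤ (2 : ℝ) ^ (⌈x⌉₊ : ℝ) := Real.rpow_le_rpow_of_exponent_le one_le_two (Nat.le_ceil x)
      _ = 2 ^ ⌈x⌉₊ := Real.rpow_natCast _ _
  · have := (Nat.ceil_lt_add_one (zero_le_one.trans hx1)).le
    calc (⌈x⌉₊ : ℝ) + 1 ≤ 3 * x := by linarith
      _ = _ := by rw [hx]; ring

/-- The number of halvings that keep a large `t` above `s` is at least logarithmic. -/
lemma exists_nat_two_pow_le {s : ℝ} (hs : 0 < s) {t : ℝ} (ht : 8 * s ^ 2 ≤ t) (ht2 : 2 ≤ t)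
    (hst : s ≤ t) :
    ∃ j : ℕ, 2 ^ j * s ≤ t ∧ (2 * Real.log 2)⁻¹ * Real.log (t + 2) ≤ j := by
  have h2 : 0 < Real.log 2 := Real.log_pos one_lt_two
  have ht0 : 0 < t := by linarith
  have hx0 : 0 ≤ Real.log (t / s) / Real.log 2 :=
    div_nonneg (Real.log_nonneg ((one_le_div hs).2 hst)) h2.le
  set x := Real.log (t / s) / Real.log 2 with hx
  refine ⟨⌊x⌋₊, ?_, ?_⟩
  · have : t / s = (2 : ℝ) ^ x := by
      rw [Real.rpow_def_of_pos two_pos, hx, mul_div_cancel₀ _ h2.ne', Real.exp_log (by positivity)]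
    rw [← le_div_iff₀ hs, this, ← Real.rpow_natCast]
    exact Real.rpow_le_rpow_of_exponent_le one_le_two (Nat.floor_le hx0)
  · have h3 : x - 1 < ⌊x⌋₊ := Nat.sub_one_lt_floor x
    have h4 : Real.log (t + 2) ≤ Real.log 2 + Real.log t := by
      rw [← Real.log_mul two_ne_zero ht0.ne']
      exact Real.log_le_log (by linarith) (by linarith)
    have h5 : 3 * Real.log 2 + 2 * Real.log s ≤ Real.log t := by
      have e : Real.log (8 * s ^ 2) = 3 * Real.log 2 + 2 * Real.log s := by
        rw [Real.log_mul (by norm_num) (by positivity), Real.log_pow,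
          show (8 : ℝ) = 2 ^ 3 by norm_num, Real.log_pow]
        norm_num
      rw [← e]
      exact Real.log_le_log (by positivity) ht
    refine le_trans ?_ h3.le
    rw [hx, Real.log_div ht0.ne' hs.ne', inv_mul_le_iff₀ (by positivity)]
    have e : 2 * Real.log 2 * ((Real.log t - Real.log s) / Real.log 2 - 1) =
        2 * (Real.log t - Real.log s) - 2 * Real.log 2 := by
      field_simp
    rw [e]
    linarith

/-- The kernel `sin(c|ξ|t)/(c|ξ|)`, with value `0` at `ξ = 0`. -/
def sinKernel {n : ℕ} (c t : ℝ) (ξ : E n) : ℝ := Real.sin (c * ‖ξ‖ * t) / (c * ‖ξ‖)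

lemma abs_sinKernel_le {n : ℕ} {c : ℝ} (hc : 0 < c) (t : ℝ) (ξ : E n) :
    |sinKernel c t ξ| ≤ (c * ‖ξ‖)⁻¹ := by
  rw [sinKernel, abs_div, abs_of_nonneg (by positivity : 0 ≤ c * ‖ξ‖), div_eq_mul_inv]
  exact mul_le_of_le_one_left (by positivity) (Real.abs_sin_le_one _)

lemma abs_sinKernel_le_time {n : ℕ} {c : ℝ} (hc : 0 < c) {t : ℝ} (ht : 0 ≤ t) (ξ : E n) :
    |sinKernel c t ξ| ≤ t := by
  rw [sinKernel, abs_div, abs_of_nonneg (by positivity : 0 ≤ c * ‖ξ‖)]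
  refine div_le_of_le_mul₀ (by positivity) ht ?_
  refine (Real.abs_sin_le_abs).trans (le_of_eq ?_)
  rw [abs_of_nonneg (by positivity)]; ring

lemma sinKernel_half_smul {n : ℕ} (c t : ℝ) (ξ : E n) :
    sinKernel c t ((1 / 2 : ℝ) • ξ) = 2 * sinKernel c (t / 2) ξ := by
  rw [sinKernel, sinKernel, norm_smul, Real.norm_of_nonneg (by norm_num : (0 : ℝ) ≤ 1 / 2)]
  rw [show c * (1 / 2 * ‖ξ‖) * t = c * ‖ξ‖ * (t / 2) by ring,
    show c * (1 / 2 * ‖ξ‖) = c * ‖ξ‖ / 2 by ring, div_div_eq_mul_div]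
  ring

lemma measurable_sinKernel {n : ℕ} (c t : ℝ) : Measurable (sinKernel (n := n) c t) :=
  Measurable.div (by fun_prop) (by fun_prop)

lemma integrableOn_sinKernel_sq {n : ℕ} {c : ℝ} (hc : 0 < c) {t : ℝ} (ht : 0 ≤ t) :
    IntegrableOn (fun ξ : E n => sinKernel c t ξ ^ 2) (Metric.ball 0 1) := by
  have : IsFiniteMeasure (volume.restrict (Metric.ball (0 : E n) 1)) :=
    ⟨by simpa using measure_ball_lt_top⟩
  refine Integrable.of_bound ((measurable_sinKernel c t).pow_const 2).aestronglyMeasurable (t ^ 2)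
    (ae_of_all _ fun ξ => ?_)
  rw [Real.norm_eq_abs, abs_pow]
  exact pow_le_pow_left₀ (abs_nonneg _) (abs_sinKernel_le_time hc ht ξ) 2

/-- In the plane, `∫_{|ξ|<1} (sin(c|ξ|t)/(c|ξ|))² dξ` grows at most logarithmically. -/
lemma exists_setIntegral_sinKernel_sq_le {c : ℝ} (hc : 0 < c) :
    ∃ C : ℝ, 0 < C ∧ ∀ t : ℝ, 0 ≤ t →
      ∫ ξ in Metric.ball (0 : E 2) 1, sinKernel c t ξ ^ 2 ≤ C * Real.log (t + 2) := by
  set V := volume.real (Metric.ball (0 : E 2) 1) with hV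
  have hV0 : 0 ≤ V := measureReal_nonneg
  have hconst : ∀ (s : Set (E 2)) (M : ℝ), MeasurableSet s → s ⊆ Metric.ball 0 1 → 0 ≤ M →
      ∀ t, 0 ≤ t → (∀ ξ ∈ s, sinKernel c t ξ ^ 2 ≤ M) → ∫ ξ in s, sinKernel c t ξ ^ 2 ≤ M * V := by
    intro s M hs hsub hM t ht hb
    have hfin : volume s ≠ ⊤ := ((measure_mono hsub).trans_lt measure_ball_lt_top).ne
    calc ∫ ξ in s, sinKernel c t ξ ^ 2 ≤ ∫ _ in s, M :=
          setIntegral_mono_on ((integrableOn_sinKernel_sq hc ht).mono_set hsub)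
            (integrableOn_const hfin) hs hb
      _ = M * volume.real s := by rw [setIntegral_const, smul_eq_mul, mul_comm]
      _ ≤ M * V := mul_le_mul_of_nonneg_left (measureReal_mono hsub measure_ball_lt_top.ne) hM
  have hring : ∀ t, 0 ≤ t → ∫ ξ in unitRing, sinKernel c t ξ ^ 2 ≤ 4 / c ^ 2 * V := by
    intro t ht
    refine hconst unitRing _ measurableSet_unitRing sdiff_subset (by positivity) t ht fun ξ hξ => ?_
    have h1 := (mem_unitRing.1 hξ).1
    have h2 : |sinKernel c t ξ| ≤ 2 / c := by
      refine (abs_sinKernel_le hc t ξ).trans ?_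
      rw [inv_le_comm₀ (by positivity) (by positivity), inv_div]
      calc c / 2 = c * (1 / 2) := by ring
        _ ≤ c * ‖ξ‖ := mul_le_mul_of_nonneg_left h1 hc.le
    calc sinKernel c t ξ ^ 2 = |sinKernel c t ξ| ^ 2 := (sq_abs _).symm
      _ ≤ (2 / c) ^ 2 := pow_le_pow_left₀ (abs_nonneg _) h2 2
      _ = 4 / c ^ 2 := by ring
  have hind : ∀ j : ℕ, ∀ t : ℝ, 0 ≤ t → t ≤ 2 ^ j →
      ∫ ξ in Metric.ball (0 : E 2) 1, sinKernel c t ξ ^ 2 ≤ V * (1 + 4 / c ^ 2 * j) := by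
    intro j
    induction j with
    | zero =>
      intro t ht0 ht1
      refine (hconst _ 1 measurableSet_ball subset_rfl zero_le_one t ht0 fun ξ _ => ?_).trans
        (le_of_eq (by simp))
      rw [pow_zero] at ht1
      calc sinKernel c t ξ ^ 2 = |sinKernel c t ξ| ^ 2 := (sq_abs _).symm
        _ ≤ 1 := pow_le_one₀ (abs_nonneg _) ((abs_sinKernel_le_time hc ht0 ξ).trans ht1)
    | succ j ih =>
      intro t ht0 ht1
      rw [setIntegral_ball_eq_unitRing_add (q := fun t ξ => sinKernel c t ξ ^ 2)
        (fun t ξ => by rw [sinKernel_half_smul]; ring) (integrableOn_sinKernel_sq hc ht0)]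
      have h1 := hring t ht0
      have h2 := ih (t / 2) (by positivity) (by rw [pow_succ] at ht1; linarith)
      push_cast
      linarith
  have h2 : 0 < Real.log 2 := Real.log_pos one_lt_two
  refine ⟨(V * (1 + 4 / c ^ 2) + 1) * (3 / Real.log 2), by positivity, fun t ht => ?_⟩
  obtain ⟨j, hj, hj'⟩ := exists_nat_le_two_pow ht
  calc _ ≤ V * (1 + 4 / c ^ 2 * j) := hind j t ht hj
    _ ≤ (V * (1 + 4 / c ^ 2) + 1) * (j + 1) := by
        have : 0 ≤ 4 / c ^ 2 := by positivity
        nlinarith [Nat.cast_nonneg (α := ℝ) j, mul_nonneg hV0 this,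
          mul_nonneg hV0 (Nat.cast_nonneg (α := ℝ) j)]
    _ ≤ (V * (1 + 4 / c ^ 2) + 1) * (3 / Real.log 2 * Real.log (t + 2)) :=
        mul_le_mul_of_nonneg_left hj' (by positivity)
    _ = _ := by ring

/-- The low frequency part of the `N`-th component of the wave with initial velocity of total
mass `m`. -/
def lead {n : ℕ} (a b : ℝ) (m : Fin n → ℝ) (N : Fin n) (t : ℝ) (ξ : E n) : ℝ :=
  sinKernel a t ξ * (m N - ∑ k, proj N k ξ * m k) + sinKernel b t ξ * ∑ k, proj N k ξ * m k

lemma proj_smul {n : ℕ} (j k : Fin n) {c : ℝ} (hc : c ≠ 0) (ξ : E n) :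
    proj j k (c • ξ) = proj j k ξ := by
  simp only [proj, PiLp.smul_apply, smul_eq_mul, norm_smul, mul_pow, Real.norm_eq_abs, sq_abs]
  rw [show c * ξ j * (c * ξ k) = c ^ 2 * (ξ j * ξ k) by ring,
    mul_div_mul_left _ _ (pow_ne_zero 2 hc)]

lemma lead_half_smul {n : ℕ} (a b : ℝ) (m : Fin n → ℝ) (N : Fin n) (t : ℝ) (ξ : E n) :
    lead a b m N t ((1 / 2 : ℝ) • ξ) = 2 * lead a b m N (t / 2) ξ := by
  simp only [lead, sinKernel_half_smul, proj_smul _ _ (by norm_num : (1 / 2 : ℝ) ≠ 0)]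
  ring

lemma measurable_coord {n : ℕ} (i : Fin n) : Measurable (fun ξ : E n => ξ i) :=
  (EuclideanSpace.proj (𝕜 := ℝ) i).continuous.measurable

lemma measurable_proj {n : ℕ} (j k : Fin n) : Measurable (proj (n := n) j k) :=
  ((measurable_coord j).mul (measurable_coord k)).div (by fun_prop)

lemma measurable_lead {n : ℕ} (a b : ℝ) (m : Fin n → ℝ) (N : Fin n) (t : ℝ) :
    Measurable (lead a b m N t) := by
  have h : Measurable (fun ξ : E n => ∑ k, proj N k ξ * m k) :=
    Finset.measurable_fun_sum _ fun k _ => (measurable_proj N k).mul_const _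
  exact ((measurable_sinKernel a t).mul (measurable_const.sub h)).add
    ((measurable_sinKernel b t).mul h)

lemma abs_sum_proj_mul_le {n : ℕ} (m : Fin n → ℝ) (N : Fin n) (ξ : E n) :
    |∑ k, proj N k ξ * m k| ≤ ∑ k, |m k| := by
  refine (Finset.abs_sum_le_sum_abs _ _).trans (Finset.sum_le_sum fun k _ => ?_)
  rw [abs_mul]
  exact mul_le_of_le_one_left (abs_nonneg _) (abs_proj_le N k ξ)

lemma abs_lead_le {n : ℕ} (a b : ℝ) (m : Fin n → ℝ) (N : Fin n) (t : ℝ) (ξ : E n) :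
    |lead a b m N t ξ| ≤ (2 * |sinKernel a t ξ| + |sinKernel b t ξ|) * ∑ k, |m k| := by
  have h1 := abs_sum_proj_mul_le m N ξ
  have h2 : |m N| ≤ ∑ k, |m k| :=
    Finset.single_le_sum (f := fun k => |m k|) (fun k _ => abs_nonneg _) (Finset.mem_univ N)
  have h3 : |m N - ∑ k, proj N k ξ * m k| ≤ 2 * ∑ k, |m k| := by
    linarith [abs_sub (m N) (∑ k, proj N k ξ * m k)]
  rw [lead]
  refine (abs_add_le _ _).trans ?_
  rw [abs_mul, abs_mul]
  nlinarith [mul_le_mul_of_nonneg_left h3 (abs_nonneg (sinKernel a t ξ)),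
    mul_le_mul_of_nonneg_left h1 (abs_nonneg (sinKernel b t ξ))]

lemma integrableOn_lead_sq {n : ℕ} {a b : ℝ} (ha : 0 < a) (hb : 0 < b) (m : Fin n → ℝ) (N : Fin n)
    {t : ℝ} (ht : 0 ≤ t) : IntegrableOn (fun ξ => lead a b m N t ξ ^ 2) (Metric.ball 0 1) := by
  have : IsFiniteMeasure (volume.restrict (Metric.ball (0 : E n) 1)) :=
    ⟨by simpa using measure_ball_lt_top⟩
  refine Integrable.of_bound ((measurable_lead a b m N t).pow_const 2).aestronglyMeasurable
    (((2 * t + t) * ∑ k, |m k|) ^ 2) (ae_of_all _ fun ξ => ?_)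
  rw [Real.norm_eq_abs, abs_pow]
  refine pow_le_pow_left₀ (abs_nonneg _) ((abs_lead_le a b m N t ξ).trans ?_) 2
  have h0 : 0 ≤ ∑ k, |m k| := Finset.sum_nonneg fun k _ => abs_nonneg _
  gcongr
  · exact abs_sinKernel_le_time ha ht ξ
  · exact abs_sinKernel_le_time hb ht ξ

/-- In the plane, the low frequency part grows at least logarithmically: each halving of the time
contributes an integral over the ring which is bounded below by the Riemann-Lebesgue lemma. -/
lemma exists_le_setIntegral_lead_sq {a b : ℝ} (ha : 0 < a) (hb : 0 < b) (hab : a ≠ b)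
    {m : Fin 2 → ℝ} (hm : m ≠ 0) (N : Fin 2) :
    ∃ c : ℝ, 0 < c ∧ ∃ T : ℝ, 0 < T ∧ ∀ t : ℝ, T ≤ t →
      c * Real.log (t + 2) ≤ ∫ ξ in Metric.ball (0 : E 2) 1, lead a b m N t ξ ^ 2 := by
  set L : E 2 → ℝ := fun ξ => ∑ k, proj N k ξ * m k with hL
  have hLc : ContinuousOn L {0}ᶜ := continuousOn_finsetSum _ fun k _ =>
    ContinuousOn.mul (fun _ hξ => (contDiffAt_proj N k hξ).continuousAt.continuousWithinAt)
      continuousOn_const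
  have hinv : ∀ c : ℝ, c ≠ 0 → ContinuousOn (fun ξ : E 2 => (c * ‖ξ‖)⁻¹) {0}ᶜ := fun c hc ξ hξ =>
    (contDiffAt_inv_norm hc hξ).continuousAt.continuousWithinAt
  set X : Fin 4 → E 2 → ℂ := ![fun _ => 0, fun _ => 0,
    fun ξ => (((a * ‖ξ‖)⁻¹ * (m N - L ξ) : ℝ) : ℂ), fun ξ => (((b * ‖ξ‖)⁻¹ * L ξ : ℝ) : ℂ)]
    with hX
  have hXc : ∀ i, ContinuousOn (X i) {0}ᶜ := by
    intro i
    fin_cases i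
    · exact continuousOn_const
    · exact continuousOn_const
    · exact Complex.continuous_ofReal.comp_continuousOn
        ((hinv a ha.ne').mul (continuousOn_const.sub hLc))
    · exact Complex.continuous_ofReal.comp_continuousOn ((hinv b hb.ne').mul hLc)
  -- the point `(1/2, 1/2)` of the ring has no vanishing coordinate
  set ξ₀ : E 2 := WithLp.toLp 2 fun _ => 1 / 2 with hξ₀def
  have hξ₀c : ∀ i, ξ₀ i = 1 / 2 := fun i => rfl
  have hsq : ‖ξ₀‖ ^ 2 = 1 / 2 := by
    rw [← sum_mul_self_eq_norm_sq]
    simp only [hξ₀c]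
    norm_num
  have hlow : 7 / 10 < ‖ξ₀‖ := by nlinarith [norm_nonneg ξ₀]
  have hhigh : ‖ξ₀‖ < 8 / 10 := by nlinarith [norm_nonneg ξ₀]
  have hξ₀ : ξ₀ ≠ 0 := norm_pos_iff.1 (by linarith)
  obtain ⟨i₀, hi₀⟩ : ∃ i, X i ξ₀ ≠ 0 := by
    by_contra! hcon
    have hnz : ∀ c : ℝ, 0 < c → (c * ‖ξ₀‖)⁻¹ ≠ 0 := fun c hc =>
      inv_ne_zero (mul_ne_zero hc.ne' (norm_ne_zero_iff.2 hξ₀))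
    have h2 : (a * ‖ξ₀‖)⁻¹ * (m N - L ξ₀) = 0 := Complex.ofReal_eq_zero.1 (hcon 2)
    have h3 : (b * ‖ξ₀‖)⁻¹ * L ξ₀ = 0 := Complex.ofReal_eq_zero.1 (hcon 3)
    have hL0 : L ξ₀ = 0 := (mul_eq_zero.1 h3).resolve_left (hnz b hb)
    have hmN : m N = 0 := by
      have := (mul_eq_zero.1 h2).resolve_left (hnz a ha)
      linarith
    have hp : ∀ k, proj N k ξ₀ = 1 / 2 := fun k => by
      rw [proj, hsq, hξ₀c]; norm_num
    have hs : m 0 + m 1 = 0 := by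
      simp only [hL, hp, Fin.sum_univ_two] at hL0
      linarith
    apply hm
    funext k
    fin_cases N <;> fin_cases k <;> simp at hmN ⊢ <;> linarith
  set K : Set (E 2) := Metric.closedBall ξ₀ (1 / 10)
  have hKr : K ⊆ unitRing := by
    intro ξ hξ
    have h : ‖ξ - ξ₀‖ ≤ 1 / 10 := by rw [← dist_eq_norm]; exact hξ
    have h1 := norm_sub_norm_le ξ₀ ξ
    have h2 := norm_sub_norm_le ξ ξ₀
    rw [norm_sub_rev] at h1
    exact mem_unitRing.2 ⟨by linarith, by linarith⟩
  have hK0 : K ⊆ {0}ᶜ := fun ξ hξ h0 => by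
    have := (mem_unitRing.1 (hKr hξ)).1
    rw [mem_singleton_iff.1 h0, norm_zero] at this
    norm_num at this
  have hint : ξ₀ ∈ interior K := interior_mono Metric.ball_subset_closedBall
    (by rw [Metric.isOpen_ball.interior_eq]; exact Metric.mem_ball_self (by norm_num))
  obtain ⟨c, hc, s, hs, h⟩ := exists_le_setIntegral_norm_sq_osc ha hb hab
    (isCompact_closedBall ξ₀ (1 / 10)) (fun i => (hXc i).mono hK0) hint hi₀
  have hring : ∀ t, s ≤ t → c ≤ ∫ ξ in unitRing, lead a b m N t ξ ^ 2 := by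
    intro t ht
    have ht0 : 0 ≤ t := hs.le.trans ht
    calc c ≤ _ := h t ht
      _ = ∫ ξ in K, lead a b m N t ξ ^ 2 := by
          refine integral_congr_ae (ae_of_all _ fun ξ => ?_)
          dsimp only
          have x0 : X 0 ξ = 0 := rfl
          have x1 : X 1 ξ = 0 := rfl
          have x2 : X 2 ξ = (((a * ‖ξ‖)⁻¹ * (m N - L ξ) : ℝ) : ℂ) := rfl
          have x3 : X 3 ξ = (((b * ‖ξ‖)⁻¹ * L ξ : ℝ) : ℂ) := rfl
          rw [x0, x1, x2, x3, mul_zero, mul_zero, zero_add, zero_add, ← Complex.ofReal_mul,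
            ← Complex.ofReal_mul, ← Complex.ofReal_add, Complex.norm_real, Real.norm_eq_abs, sq_abs]
          simp only [lead, sinKernel, hL]
          ring
      _ ≤ _ := setIntegral_mono_set ((integrableOn_lead_sq ha hb m N ht0).mono_set sdiff_subset)
          (ae_of_all _ fun ξ => sq_nonneg _) hKr.eventuallyLE
  have hind : ∀ j : ℕ, ∀ t : ℝ, 2 ^ j * s ≤ t →
      c * j ≤ ∫ ξ in Metric.ball (0 : E 2) 1, lead a b m N t ξ ^ 2 := by
    intro j
    induction j with
    | zero =>
      intro t _
      simpa using integral_nonneg fun ξ => sq_nonneg (lead a b m N t ξ)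
    | succ j ih =>
      intro t ht
      have h1 : (1 : ℝ) ≤ 2 ^ (j + 1) := one_le_pow₀ one_le_two
      have hst : s ≤ t := (le_mul_of_one_le_left hs.le h1).trans ht
      rw [setIntegral_ball_eq_unitRing_add (q := fun t ξ => lead a b m N t ξ ^ 2)
        (fun t ξ => by rw [lead_half_smul]; ring)
        (integrableOn_lead_sq ha hb m N (hs.le.trans hst))]
      have h2 := hring t hst
      have h3 := ih (t / 2) (by rw [pow_succ] at ht; linarith)
      push_cast
      linarith
  have h2 : 0 < Real.log 2 := Real.log_pos one_lt_two
  refine ⟨c * (2 * Real.log 2)⁻¹, by positivity, max (8 * s ^ 2) (max 2 s), by positivity,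
    fun t ht => ?_⟩
  simp only [max_le_iff] at ht
  obtain ⟨j, hj, hj'⟩ := exists_nat_two_pow_le hs ht.1 ht.2.1 ht.2.2
  refine le_trans ?_ (hind j t hj)
  rw [mul_assoc]
  exact mul_le_mul_of_nonneg_left hj' hc.le

/-! ### Comparison with the low frequency part -/

section Comparison

variable {n : ℕ} {a b : ℝ} {f₀ f₁ : Fin n → L2 n}

lemma norm_waveHat_data_zero_le (N : Fin n) (t : ℝ) (ξ : E n) :
    ‖(Real.cos (a * ‖ξ‖ * t) : ℂ) * transv f₀ N ξ + Real.cos (b * ‖ξ‖ * t) * longit f₀ N ξ‖ ≤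
      3 * ∑ k, ‖ft (f₀ k) ξ‖ := by
  have hcos : ∀ (x : ℝ) (z : ℂ), ‖(Real.cos x : ℂ) * z‖ ≤ ‖z‖ := fun x z => by
    rw [norm_mul, Complex.norm_real]
    exact mul_le_of_le_one_left (norm_nonneg _) (Real.abs_cos_le_one x)
  refine (norm_add_le _ _).trans ((add_le_add (hcos _ _) (hcos _ _)).trans ?_)
  linarith [norm_transv_le f₀ N ξ, norm_longit_le f₀ N ξ]

/-- At high frequencies the solution is controlled by the data in `L²`. -/
lemma norm_waveHat_le (ha : 0 < a) (hb : 0 < b) (N : Fin n) (t : ℝ) {ξ : E n} (hξ : 1 ≤ ‖ξ‖) :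
    ‖waveHat a b f₀ f₁ N t ξ‖ ≤
      3 * ∑ k, ‖ft (f₀ k) ξ‖ + (2 / a + 1 / b) * ∑ k, ‖ft (f₁ k) ξ‖ := by
  have h : ∀ c : ℝ, 0 < c → |sinKernel c t ξ| ≤ 1 / c := fun c hc => by
    refine (abs_sinKernel_le hc t ξ).trans ?_
    rw [one_div]
    exact inv_anti₀ hc (le_mul_of_one_le_right hc.le hξ)
  have e : waveHat a b f₀ f₁ N t ξ = ((Real.cos (a * ‖ξ‖ * t) : ℂ) * transv f₀ N ξ +
      Real.cos (b * ‖ξ‖ * t) * longit f₀ N ξ) + ((sinKernel a t ξ : ℂ) * transv f₁ N ξ +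
      (sinKernel b t ξ : ℂ) * longit f₁ N ξ) := by
    simp only [waveHat, sinKernel]; ring
  rw [e]
  refine (norm_add_le _ _).trans (add_le_add (norm_waveHat_data_zero_le N t ξ)
    ((norm_add_le _ _).trans ?_))
  rw [norm_mul, norm_mul, Complex.norm_real, Complex.norm_real, Real.norm_eq_abs, Real.norm_eq_abs]
  have h1 := mul_le_mul (h a ha) (norm_transv_le f₁ N ξ) (norm_nonneg _) (by positivity)
  have h2 := mul_le_mul (h b hb) (norm_longit_le f₁ N ξ) (norm_nonneg _) (by positivity)
  refine (add_le_add h1 h2).trans (le_of_eq ?_)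
  ring

/-- The first order Taylor expansion of the Fourier transform at zero compensates for the
singularity of `1/|ξ|`. -/
lemma norm_waveHat_sub_lead_le (ha : 0 < a) (hb : 0 < b) (h₁ : ∀ k, MemL11 (f₁ k)) (N : Fin n)
    (t : ℝ) (ξ : E n) :
    ‖waveHat a b f₀ f₁ N t ξ - lead a b (moment0 f₁) N t ξ‖ ≤
      3 * ∑ k, ‖ft (f₀ k) ξ‖ + 2 * Real.pi * (2 / a + 1 / b) * norm11 f₁ := by
  set z : Fin n → ℂ := fun k => ft (f₁ k) ξ - (moment0 f₁ k : ℂ) with hz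
  have e : waveHat a b f₀ f₁ N t ξ - lead a b (moment0 f₁) N t ξ =
      ((Real.cos (a * ‖ξ‖ * t) : ℂ) * transv f₀ N ξ +
      Real.cos (b * ‖ξ‖ * t) * longit f₀ N ξ) +
      ((sinKernel a t ξ : ℂ) * (z N - ∑ k, (proj N k ξ : ℂ) * z k) +
      (sinKernel b t ξ : ℂ) * ∑ k, (proj N k ξ : ℂ) * z k) := by
    simp only [waveHat, lead, transv, longit, hz, mul_sub, Finset.sum_sub_distrib]
    push_cast [sinKernel]
    ring
  have hzle : ∑ k, ‖z k‖ ≤ 2 * Real.pi * ‖ξ‖ * norm11 f₁ := by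
    rw [norm11_eq, Finset.mul_sum]
    exact Finset.sum_le_sum fun k _ => norm_ft_sub_le (h₁ k) ξ
  have h11 : 0 ≤ norm11 f₁ := by
    rw [norm11_eq]; exact Finset.sum_nonneg fun k _ => wnorm_nonneg _
  have hzn : 0 ≤ ∑ k, ‖z k‖ := Finset.sum_nonneg fun k _ => norm_nonneg _
  have hker : ∀ c : ℝ, 0 < c → |sinKernel c t ξ| * ∑ k, ‖z k‖ ≤ 2 * Real.pi / c * norm11 f₁ := by
    intro c hc
    refine (mul_le_mul (abs_sinKernel_le hc t ξ) hzle hzn (by positivity)).trans ?_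
    rcases eq_or_ne ‖ξ‖ 0 with h0 | h0
    · rw [h0]
      simp only [mul_zero, inv_zero, zero_mul]
      have := Real.pi_pos
      positivity
    · refine le_of_eq ?_
      field_simp
  rw [e]
  refine (norm_add_le _ _).trans (add_le_add (norm_waveHat_data_zero_le N t ξ)
    ((norm_add_le _ _).trans ?_))
  rw [norm_mul, norm_mul, Complex.norm_real, Complex.norm_real, Real.norm_eq_abs, Real.norm_eq_abs]
  have h1 := mul_le_mul_of_nonneg_left (norm_sub_sum_proj_mul_le N ξ z)
    (abs_nonneg (sinKernel a t ξ))
  have h2 := mul_le_mul_of_nonneg_left (norm_sum_proj_mul_le N ξ z) (abs_nonneg (sinKernel b t ξ))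
  have h3 := hker a ha
  have h4 := hker b hb
  calc _ ≤ 2 * (|sinKernel a t ξ| * ∑ k, ‖z k‖) + |sinKernel b t ξ| * ∑ k, ‖z k‖ := by linarith
    _ ≤ 2 * (2 * Real.pi / a * norm11 f₁) + 2 * Real.pi / b * norm11 f₁ := by linarith
    _ = _ := by ring

end Comparison

lemma absM_nonneg {n : ℕ} (f : Fin n → L2 n) : 0 ≤ absM f :=
  Finset.sum_nonneg fun _ _ => abs_nonneg _

lemma norm11_nonneg {n : ℕ} (f : Fin n → L2 n) : 0 ≤ norm11 f :=
  Finset.sum_nonneg fun _ _ => wnorm_nonneg _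

lemma norm2_nonneg {n : ℕ} (f : Fin n → L2 n) : 0 ≤ norm2 f :=
  Finset.sum_nonneg fun _ _ => norm_nonneg _

lemma absP_nonneg {n : ℕ} (f : Fin n → L2 n) (k : Fin n) : 0 ≤ absP f k :=
  Finset.sum_nonneg fun _ _ => abs_nonneg _

lemma absPP_nonneg {n : ℕ} (f : Fin n → L2 n) (N : Fin n) : 0 ≤ absPP f N := by
  have h1 : 0 ≤ ∑ k, |moment1 f k N| := Finset.sum_nonneg fun _ _ => abs_nonneg _
  have h2 : 0 ≤ ∑ k, |moment1 f k k| := Finset.sum_nonneg fun _ _ => abs_nonneg _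
  have h3 : 0 ≤ ∑ k, ∑ l, if k < l ∧ k ≠ N ∧ l ≠ N then |moment1 f k l + moment1 f l k| else 0 :=
    Finset.sum_nonneg fun k _ => Finset.sum_nonneg fun l _ => by split_ifs <;> positivity
  have := absP_nonneg f N
  rw [absPP]
  linarith

/-- In the plane every first moment occurs in `absPP f N`. -/
lemma absPP_ne_zero {f : Fin 2 → L2 2} (h : ∑ k, absP f k ≠ 0) (N : Fin 2) : absPP f N ≠ 0 := by
  intro h0
  apply h
  have h1 : ∀ k, |moment1 f k N| ≤ ∑ k, |moment1 f k N| := fun k =>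
    Finset.single_le_sum (f := fun k => |moment1 f k N|) (fun _ _ => abs_nonneg _)
      (Finset.mem_univ k)
  have h2 : ∀ k, |moment1 f k k| ≤ ∑ k, |moment1 f k k| := fun k =>
    Finset.single_le_sum (f := fun k => |moment1 f k k|) (fun _ _ => abs_nonneg _)
      (Finset.mem_univ k)
  have h3 : ∀ l, |moment1 f N l| ≤ absP f N := fun l =>
    Finset.single_le_sum (f := fun l => |moment1 f N l|) (fun _ _ => abs_nonneg _)
      (Finset.mem_univ l)
  have h4 : 0 ≤ ∑ k, ∑ l, if k < l ∧ k ≠ N ∧ l ≠ N then |moment1 f k l + moment1 f l k| else 0 :=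
    Finset.sum_nonneg fun k _ => Finset.sum_nonneg fun l _ => by split_ifs <;> positivity
  rw [absPP] at h0
  have hz : ∀ k l, moment1 f k l = 0 := by
    intro k l
    refine abs_eq_zero.1 (le_antisymm ?_ (abs_nonneg _))
    have hcases : k = N ∨ l = N ∨ k = l := by omega
    have a1 := absP_nonneg f N
    have a2 : 0 ≤ ∑ k, |moment1 f k N| := Finset.sum_nonneg fun _ _ => abs_nonneg _
    have a3 : 0 ≤ ∑ k, |moment1 f k k| := Finset.sum_nonneg fun _ _ => abs_nonneg _
    rcases hcases with rfl | rfl | rfl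
    · linarith [h3 l]
    · linarith [h1 k]
    · linarith [h2 k]
  simp [absP, hz]

/-! ### Bounds for plane waves -/

/-- A nonvanishing total initial velocity makes every component of a plane wave grow. -/
theorem exists_sqrt_log_le_norm {lam mu : ℝ} (hmu : 0 < mu) (hlam : 0 < lam + 2 * mu)
    (hne : lam + mu ≠ 0) {f₀ f₁ : Fin 2 → L2 2} (N : Fin 2) (hd : IsData f₀ f₁)
    (hM : absM f₁ ≠ 0) :
    ∃ c : ℝ, 0 < c ∧ ∃ T : ℝ, 0 < T ∧ ∀ u : ℝ → Fin 2 → L2 2, IsSolution lam mu f₀ f₁ u →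
      ∀ t : ℝ, T ≤ t → c * √(Real.log (t + 2)) ≤ ‖u t N‖ := by
  have ha := freq_pos hmu
  have hb := freq_pos hlam
  have hm : moment0 f₁ ≠ 0 := fun h => hM (by simp [absM, h])
  obtain ⟨c, hc, T, hT, h⟩ := exists_le_setIntegral_lead_sq ha hb (freq_ne hmu hlam hne) hm N
  set a := freq mu
  set b := freq (lam + 2 * mu)
  set D := 3 * norm11 f₀ + 2 * Real.pi * (2 / a + 1 / b) * norm11 f₁
  set V := volume.real (Metric.ball (0 : E 2) 1)
  refine ⟨√(c / 4), by positivity, max T (Real.exp (4 * D ^ 2 * V / c)), by positivity,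
    fun u hu t ht => ?_⟩
  simp only [max_le_iff] at ht
  have ht0 : 0 ≤ t := hT.le.trans ht.1
  have hpt : ∀ ξ, lead a b (moment0 f₁) N t ξ ^ 2 ≤
      2 * ‖waveHat a b f₀ f₁ N t ξ‖ ^ 2 + 2 * D ^ 2 := by
    intro ξ
    have h1 := norm_waveHat_sub_lead_le (f₀ := f₀) ha hb hd.memL11_one N t ξ
    have h2 : ∑ k, ‖ft (f₀ k) ξ‖ ≤ norm11 f₀ := by
      rw [norm11_eq]; exact Finset.sum_le_sum fun k _ => norm_ft_le (hd.memL11_zero k) ξ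
    have h3 : |lead a b (moment0 f₁) N t ξ| ≤ ‖waveHat a b f₀ f₁ N t ξ‖ + D := by
      have h4 := norm_sub_norm_le (lead a b (moment0 f₁) N t ξ : ℂ) (waveHat a b f₀ f₁ N t ξ)
      rw [norm_sub_rev, Complex.norm_real, Real.norm_eq_abs] at h4
      simp only [D]
      linarith
    calc lead a b (moment0 f₁) N t ξ ^ 2 = |lead a b (moment0 f₁) N t ξ| ^ 2 := (sq_abs _).symm
      _ ≤ (‖waveHat a b f₀ f₁ N t ξ‖ + D) ^ 2 := pow_le_pow_left₀ (abs_nonneg _) h3 2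
      _ ≤ _ := by nlinarith [sq_nonneg (‖waveHat a b f₀ f₁ N t ξ‖ - D)]
  have hI := (hu.integrable_norm_waveHat_sq hmu hlam hd ht0 N).integrableOn
    (s := Metric.ball (0 : E 2) 1)
  have hcI : IntegrableOn (fun _ => 2 * D ^ 2) (Metric.ball (0 : E 2) 1) :=
    integrableOn_const measure_ball_lt_top.ne
  have hle : c * Real.log (t + 2) ≤ 2 * ‖u t N‖ ^ 2 + 2 * D ^ 2 * V := by
    calc c * Real.log (t + 2) ≤ _ := h t ht.1
      _ ≤ ∫ ξ in Metric.ball (0 : E 2) 1, (2 * ‖waveHat a b f₀ f₁ N t ξ‖ ^ 2 + 2 * D ^ 2) :=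
          integral_mono (integrableOn_lead_sq ha hb _ N ht0) ((hI.const_mul 2).add hcI) hpt
      _ = 2 * (∫ ξ in Metric.ball (0 : E 2) 1, ‖waveHat a b f₀ f₁ N t ξ‖ ^ 2) + 2 * D ^ 2 * V := by
          rw [integral_add (hI.const_mul 2) hcI, integral_const_mul, setIntegral_const, smul_eq_mul]
          ring
      _ ≤ _ := by
          have := hu.setIntegral_le_norm_sq hmu hlam hd ht0 N (Metric.ball 0 1)
          linarith
  have hlog : 4 * D ^ 2 * V ≤ c * Real.log (t + 2) := by
    have : 4 * D ^ 2 * V / c ≤ Real.log (t + 2) := by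
      rw [← Real.log_exp (4 * D ^ 2 * V / c)]
      exact Real.log_le_log (Real.exp_pos _) (by linarith)
    rwa [div_le_iff₀' hc] at this
  rw [← Real.sqrt_mul (by positivity)]
  refine Real.sqrt_le_iff.2 ⟨norm_nonneg _, ?_⟩
  linarith

lemma integral_sum_norm_ft_sq_le {f : Fin 2 → L2 2} (hf : ∀ k, Integrable (f k)) :
    Integrable (fun ξ => (∑ k, ‖ft (f k) ξ‖) ^ 2) ∧
      ∫ ξ, (∑ k, ‖ft (f k) ξ‖) ^ 2 ≤ 2 * norm2 f ^ 2 := by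
  have hpt : ∀ ξ, (∑ k, ‖ft (f k) ξ‖) ^ 2 ≤ 2 * ∑ k, ‖ft (f k) ξ‖ ^ 2 := fun ξ => by
    simpa using sq_sum_le_card_mul_sum_sq (s := Finset.univ) (f := fun k => ‖ft (f k) ξ‖)
  have hI : Integrable (fun ξ => 2 * ∑ k, ‖ft (f k) ξ‖ ^ 2) :=
    (integrable_finsetSum _ fun k _ => integrable_norm_ft_sq (hf k)).const_mul 2
  have hI' : Integrable (fun ξ => (∑ k, ‖ft (f k) ξ‖) ^ 2) := by
    refine hI.mono' (Continuous.aestronglyMeasurable ?_) (ae_of_all _ fun ξ => ?_)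
    · exact (continuous_finsetSum _ fun k _ => (continuous_ft (hf k)).norm).pow 2
    · rw [Real.norm_of_nonneg (by positivity)]
      exact hpt ξ
  refine ⟨hI', (integral_mono hI' hI hpt).trans ?_⟩
  rw [integral_const_mul, integral_finsetSum _ fun k _ => integrable_norm_ft_sq (hf k)]
  simp only [integral_norm_ft_sq (hf _), norm2, Fin.sum_univ_two]
  nlinarith [mul_nonneg (norm_nonneg (f 0)) (norm_nonneg (f 1))]

/-- The majorant of the squared low frequency part on the unit disc. -/
def lowMajorant {n : ℕ} (a b M W t : ℝ) (ξ : E n) : ℝ :=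
  8 * M ^ 2 * sinKernel a t ξ ^ 2 + 2 * M ^ 2 * sinKernel b t ξ ^ 2 + W ^ 2

lemma norm_waveHat_sq_le {n : ℕ} {a b : ℝ} (ha : 0 < a) (hb : 0 < b) {f₀ f₁ : Fin n → L2 n}
    (h₁ : ∀ k, MemL11 (f₁ k)) (N : Fin n) (t : ℝ) (ξ : E n) :
    ‖waveHat a b f₀ f₁ N t ξ‖ ^ 2 ≤
      4 * (9 * (∑ k, ‖ft (f₀ k) ξ‖) ^ 2 + (2 / a + 1 / b) ^ 2 * (∑ k, ‖ft (f₁ k) ξ‖) ^ 2 +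
        (Metric.ball 0 1).indicator (lowMajorant a b (absM f₁)
          (2 * Real.pi * (2 / a + 1 / b) * norm11 f₁) t) ξ) := by
  by_cases hξ : ξ ∈ Metric.ball (0 : E n) 1
  · rw [indicator_of_mem hξ]
    have h1 := norm_waveHat_sub_lead_le (f₀ := f₀) ha hb h₁ N t ξ
    have h2 : |lead a b (moment0 f₁) N t ξ| ≤
        (2 * |sinKernel a t ξ| + |sinKernel b t ξ|) * absM f₁ := abs_lead_le a b _ N t ξ
    have h4 := norm_sub_norm_le (waveHat a b f₀ f₁ N t ξ) (lead a b (moment0 f₁) N t ξ : ℂ)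
    rw [Complex.norm_real, Real.norm_eq_abs] at h4
    set S := ∑ k, ‖ft (f₀ k) ξ‖
    set S' := ∑ k, ‖ft (f₁ k) ξ‖
    set W := 2 * Real.pi * (2 / a + 1 / b) * norm11 f₁
    set p := |sinKernel a t ξ| * absM f₁ with hp
    set q := |sinKernel b t ξ| * absM f₁ with hq
    have h3 : ‖waveHat a b f₀ f₁ N t ξ‖ ≤ 3 * S + W + (2 * p + q) := by
      rw [hp, hq]; linarith
    have e1 : lowMajorant a b (absM f₁) W t ξ = 8 * p ^ 2 + 2 * q ^ 2 + W ^ 2 := by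
      simp only [lowMajorant, hp, hq, mul_pow, sq_abs]; ring
    have h7 : 0 ≤ (2 / a + 1 / b) ^ 2 * S' ^ 2 := by positivity
    rw [e1]
    refine (pow_le_pow_left₀ (norm_nonneg _) h3 2).trans ?_
    nlinarith [sq_nonneg (3 * S - W), sq_nonneg (3 * S - (2 * p + q)),
      sq_nonneg (W - (2 * p + q)), sq_nonneg (2 * p - q)]
  · rw [indicator_of_notMem hξ]
    have hξ1 : 1 ≤ ‖ξ‖ := by simpa using hξ
    refine (pow_le_pow_left₀ (norm_nonneg _)
      (norm_waveHat_le (f₀ := f₀) (f₁ := f₁) ha hb N t hξ1) 2).trans ?_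
    set S := ∑ k, ‖ft (f₀ k) ξ‖
    set S' := (2 / a + 1 / b) * ∑ k, ‖ft (f₁ k) ξ‖ with hS'
    rw [← mul_pow, ← hS']
    nlinarith [sq_nonneg (3 * S - S'), sq_nonneg (3 * S), sq_nonneg S']

lemma integrableOn_lowMajorant {n : ℕ} {a b : ℝ} (ha : 0 < a) (hb : 0 < b) (M W : ℝ) {t : ℝ}
    (ht : 0 ≤ t) : IntegrableOn (lowMajorant a b M W t) (Metric.ball (0 : E n) 1) :=
  (((integrableOn_sinKernel_sq ha ht).const_mul _).add
    ((integrableOn_sinKernel_sq hb ht).const_mul _)).add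
    (integrableOn_const measure_ball_lt_top.ne)

lemma setIntegral_lowMajorant {n : ℕ} {a b : ℝ} (ha : 0 < a) (hb : 0 < b) (M W : ℝ) {t : ℝ}
    (ht : 0 ≤ t) : ∫ ξ in Metric.ball (0 : E n) 1, lowMajorant a b M W t ξ =
      8 * M ^ 2 * (∫ ξ in Metric.ball (0 : E n) 1, sinKernel a t ξ ^ 2) +
      2 * M ^ 2 * (∫ ξ in Metric.ball (0 : E n) 1, sinKernel b t ξ ^ 2) +
      W ^ 2 * volume.real (Metric.ball (0 : E n) 1) := by
  have hga : IntegrableOn (fun ξ : E n => 8 * M ^ 2 * sinKernel a t ξ ^ 2) (Metric.ball 0 1) :=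
    (integrableOn_sinKernel_sq ha ht).const_mul _
  have hgb : IntegrableOn (fun ξ : E n => 2 * M ^ 2 * sinKernel b t ξ ^ 2) (Metric.ball 0 1) :=
    (integrableOn_sinKernel_sq hb ht).const_mul _
  have hgc : IntegrableOn (fun _ : E n => W ^ 2) (Metric.ball 0 1) :=
    integrableOn_const measure_ball_lt_top.ne
  have hgab : IntegrableOn (fun ξ : E n => 8 * M ^ 2 * sinKernel a t ξ ^ 2 +
      2 * M ^ 2 * sinKernel b t ξ ^ 2) (Metric.ball 0 1) := hga.add hgb
  simp only [lowMajorant]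
  rw [integral_add hgab hgc, integral_add hga hgb, integral_const_mul, integral_const_mul,
    setIntegral_const, smul_eq_mul, mul_comm (volume.real _)]

/-- The upper bound for plane waves, with a constant that depends only on the Lamé parameters. -/
theorem exists_norm_le {lam mu : ℝ} (hmu : 0 < mu) (hlam : 0 < lam + 2 * mu) :
    ∃ C : ℝ, 0 < C ∧ ∀ (f₀ f₁ : Fin 2 → L2 2) (u : ℝ → Fin 2 → L2 2), IsData f₀ f₁ →
      IsSolution lam mu f₀ f₁ u → ∀ (N : Fin 2) (t : ℝ), 0 ≤ t →
        ‖u t N‖ ≤ C * (norm2 f₀ + absM f₁ * √(Real.log (t + 2)) + norm11 f₁ + norm2 f₁) := by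
  have ha := freq_pos hmu
  have hb := freq_pos hlam
  obtain ⟨Ca, hCa, hJa⟩ := exists_setIntegral_sinKernel_sq_le ha
  obtain ⟨Cb, hCb, hJb⟩ := exists_setIntegral_sinKernel_sq_le hb
  set V := volume.real (Metric.ball (0 : E 2) 1) with hVdef
  have hV : 0 ≤ V := measureReal_nonneg
  obtain ⟨κ, hκ⟩ : ∃ κ, κ = 2 / freq mu + 1 / freq (lam + 2 * mu) := ⟨_, rfl⟩
  obtain ⟨C, hC⟩ : ∃ C, C = 4 * (18 + 2 * κ ^ 2 + (8 * Ca + 2 * Cb) + (2 * Real.pi * κ) ^ 2 * V) :=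
    ⟨_, rfl⟩
  have hC0 : 0 < C := by rw [hC]; positivity
  refine ⟨√C, Real.sqrt_pos.2 hC0, fun f₀ f₁ u hd hu N t ht => ?_⟩
  obtain ⟨hi0, hb0⟩ := integral_sum_norm_ft_sq_le fun k => (hd.memL11_zero k).integrable
  obtain ⟨hi1, hb1⟩ := integral_sum_norm_ft_sq_le fun k => (hd.memL11_one k).integrable
  have hpt := fun ξ => norm_waveHat_sq_le (f₀ := f₀) ha hb hd.memL11_one N t ξ
  rw [← hκ] at hpt
  obtain ⟨W, hW⟩ : ∃ W, W = 2 * Real.pi * κ * norm11 f₁ := ⟨_, rfl⟩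
  rw [← hW] at hpt
  have hgI : Integrable ((Metric.ball (0 : E 2) 1).indicator
      (lowMajorant (freq mu) (freq (lam + 2 * mu)) (absM f₁) W t)) :=
    (integrableOn_lowMajorant ha hb _ _ ht).integrable_indicator measurableSet_ball
  have hL0 : 0 ≤ Real.log (t + 2) := Real.log_nonneg (by linarith)
  obtain ⟨X, hX⟩ : ∃ X, X = norm2 f₀ + absM f₁ * √(Real.log (t + 2)) + norm11 f₁ + norm2 f₁ :=
    ⟨_, rfl⟩
  rw [← hX]
  have n0 := norm2_nonneg f₀
  have n1 := norm2_nonneg f₁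
  have n2 := norm11_nonneg f₁
  have n3 : 0 ≤ absM f₁ * √(Real.log (t + 2)) := mul_nonneg (absM_nonneg f₁) (Real.sqrt_nonneg _)
  have x0 : norm2 f₀ ^ 2 ≤ X ^ 2 := pow_le_pow_left₀ n0 (by linarith) 2
  have x1 : norm2 f₁ ^ 2 ≤ X ^ 2 := pow_le_pow_left₀ n1 (by linarith) 2
  have x2 : norm11 f₁ ^ 2 ≤ X ^ 2 := pow_le_pow_left₀ n2 (by linarith) 2
  have x3 : absM f₁ ^ 2 * Real.log (t + 2) ≤ X ^ 2 := by
    have := pow_le_pow_left₀ n3 (by linarith : _ ≤ X) 2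
    rwa [mul_pow, Real.sq_sqrt hL0] at this
  have hgle : ∫ ξ, (Metric.ball (0 : E 2) 1).indicator
      (lowMajorant (freq mu) (freq (lam + 2 * mu)) (absM f₁) W t) ξ ≤
      (8 * Ca + 2 * Cb) * X ^ 2 + (2 * Real.pi * κ) ^ 2 * V * X ^ 2 := by
    rw [integral_indicator measurableSet_ball, setIntegral_lowMajorant ha hb _ _ ht, ← hVdef, hW,
      mul_pow _ (norm11 f₁)]
    have h1 := mul_le_mul_of_nonneg_left (hJa t ht) (by positivity : 0 ≤ 8 * absM f₁ ^ 2)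
    have h2 := mul_le_mul_of_nonneg_left (hJb t ht) (by positivity : 0 ≤ 2 * absM f₁ ^ 2)
    have h3 := mul_le_mul_of_nonneg_left x3 (by positivity : 0 ≤ 8 * Ca + 2 * Cb)
    have h4 := mul_le_mul_of_nonneg_left x2 (by positivity : 0 ≤ (2 * Real.pi * κ) ^ 2 * V)
    linarith
  have hmain : ‖u t N‖ ^ 2 ≤ C * X ^ 2 := by
    rw [hu.norm_sq_eq hmu hlam hd ht N]
    have i01 := (hi0.const_mul 9).add (hi1.const_mul (κ ^ 2))
    refine (integral_mono (hu.integrable_norm_waveHat_sq hmu hlam hd ht N)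
      ((i01.add hgI).const_mul 4) hpt).trans ?_
    rw [integral_const_mul]
    have e := integral_add i01 hgI
    have e' := integral_add (hi0.const_mul 9) (hi1.const_mul (κ ^ 2))
    rw [integral_const_mul, integral_const_mul] at e'
    refine (mul_le_mul_of_nonneg_left (e.trans (congrArg (· + _) e')).le
      (by norm_num : (0 : ℝ) ≤ 4)).trans ?_
    have y1 := mul_le_mul_of_nonneg_left (hb1.trans (mul_le_mul_of_nonneg_left x1 two_pos.le))
      (sq_nonneg κ)
    rw [hC]
    linarith
  have hX0 : 0 ≤ X := by linarith
  rw [← Real.sqrt_sq hX0, ← Real.sqrt_mul hC0.le]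
  exact Real.le_sqrt_of_sq_le hmain

lemma eq_zero_of_norm11_eq_zero {n : ℕ} {f : Fin n → L2 n} (hf : ∀ k, MemL11 (f k))
    (h : norm11 f = 0) (k : Fin n) : f k = 0 := by
  have h1 : wnorm (f k) = 0 :=
    (Finset.sum_eq_zero_iff_of_nonneg fun k _ => wnorm_nonneg (f k)).1 h k (Finset.mem_univ k)
  have h2 := (integral_eq_zero_iff_of_nonneg (fun x => by positivity)
    (hf k).integrable_weight).1 h1
  refine (Lp.eq_zero_iff_ae_eq_zero).2 ?_
  filter_upwards [h2] with x hx
  have hw : (1 + ‖x‖) ≠ 0 := by positivity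
  exact abs_eq_zero.1 ((mul_eq_zero.1 hx).resolve_left hw)

end

end ElasticWave

theorem theorem1p4 (lam mu : ℝ) (hlam : 0 < lam + 2 * mu) (hmu : 0 < mu) :
    -- the upper bound for `n = 2`, with a constant depending only on `λ` and `μ`
    (∃ C : ℝ, 0 < C ∧ ∀ (f₀ f₁ : Fin 2 → ElasticWave.L2 2) (u : ℝ → Fin 2 → ElasticWave.L2 2),
      ElasticWave.IsData f₀ f₁ → ElasticWave.IsSolution lam mu f₀ f₁ u →
        ∀ (N : Fin 2) (t : ℝ), 0 ≤ t →
          ‖u t N‖ ≤ C * (ElasticWave.norm2 f₀ + ElasticWave.absM f₁ * √(Real.log (t + 2))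
            + ElasticWave.norm11 f₁ + ElasticWave.norm2 f₁)) ∧
    -- the upper bound for `n = 2`, with a constant depending also on the data
    (∀ f₀ f₁ : Fin 2 → ElasticWave.L2 2, ElasticWave.IsData f₀ f₁ →
      ∃ C : ℝ, 0 < C ∧ ∀ u : ℝ → Fin 2 → ElasticWave.L2 2,
        ElasticWave.IsSolution lam mu f₀ f₁ u → ∀ (N : Fin 2) (t : ℝ), 0 ≤ t →
          ‖u t N‖ ≤ C * (ElasticWave.norm2 f₀ + ElasticWave.absM f₁ * √(Real.log (t + 2))
            + ElasticWave.norm11 f₁)) ∧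
    (lam + mu ≠ 0 →
      -- the lower bound for `n = 2`
      (∀ (f₀ f₁ : Fin 2 → ElasticWave.L2 2) (N : Fin 2), ElasticWave.IsData f₀ f₁ →
        ∑ k, ElasticWave.absP f₀ k + ∑ k, ElasticWave.absP f₁ k ≠ 0 →
        ∃ C : ℝ, 0 < C ∧ ∃ T : ℝ, 0 < T ∧ ∀ u : ℝ → Fin 2 → ElasticWave.L2 2,
          ElasticWave.IsSolution lam mu f₀ f₁ u → ∀ t : ℝ, T ≤ t →
            C * (ElasticWave.absM f₀ + ElasticWave.absM f₁ * √(Real.log (t + 2))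
              + (∑ k, ElasticWave.absP f₀ k + ∑ k, ElasticWave.absP f₁ k)) ≤ ‖u t N‖) ∧
      -- the lower bound for `n ≥ 3`
      (∀ (n : ℕ), 3 ≤ n → ∀ (f₀ f₁ : Fin n → ElasticWave.L2 n) (N : Fin n),
        ElasticWave.IsData f₀ f₁ →
        ElasticWave.absPP f₀ N ≠ 0 ∨ ElasticWave.absPP f₁ N ≠ 0 →
        ∃ C : ℝ, 0 < C ∧ ∃ T : ℝ, 0 < T ∧ ∀ u : ℝ → Fin n → ElasticWave.L2 n,
          ElasticWave.IsSolution lam mu f₀ f₁ u → ∀ t : ℝ, T ≤ t →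
            C * (ElasticWave.absM f₀ + ElasticWave.absM f₁
              + ElasticWave.absPP f₀ N + ElasticWave.absPP f₁ N) ≤ ‖u t N‖)) := by
  open ElasticWave in
  refine ⟨exists_norm_le hmu hlam, fun f₀ f₁ hd => ?_, fun hne => ⟨fun f₀ f₁ N hd hP => ?_,
    fun n _ f₀ f₁ N hd hP => ?_⟩⟩
  · obtain ⟨C, hC, h⟩ := exists_norm_le hmu hlam
    -- for fixed data, `‖f₁‖₂` is at most a multiple of `‖f₁‖_{1,1}`
    obtain ⟨K, hK, hle⟩ : ∃ K : ℝ, 0 ≤ K ∧ norm2 f₁ ≤ K * norm11 f₁ := by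
      rcases eq_or_ne (norm11 f₁) 0 with h0 | h0
      · refine ⟨0, le_rfl, ?_⟩
        simp [norm2, eq_zero_of_norm11_eq_zero hd.memL11_one h0]
      · exact ⟨norm2 f₁ / norm11 f₁, div_nonneg (norm2_nonneg _) (norm11_nonneg _),
          (div_mul_cancel₀ _ h0).ge⟩
    refine ⟨C * (1 + K), by positivity, fun u hu N t ht => (h f₀ f₁ u hd hu N t ht).trans ?_⟩
    rw [mul_assoc]
    refine mul_le_mul_of_nonneg_left ?_ hC.le
    have n3 : 0 ≤ absM f₁ * √(Real.log (t + 2)) := mul_nonneg (absM_nonneg f₁) (Real.sqrt_nonneg _)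
    nlinarith [mul_nonneg hK (norm2_nonneg f₀), mul_nonneg hK n3]
  · have p0 : 0 ≤ ∑ k, absP f₀ k := Finset.sum_nonneg fun k _ => absP_nonneg f₀ k
    have p1 : 0 ≤ ∑ k, absP f₁ k := Finset.sum_nonneg fun k _ => absP_nonneg f₁ k
    have m0 := absM_nonneg f₀
    have m1 := absM_nonneg f₁
    rcases eq_or_ne (absM f₁) 0 with hM | hM
    · have hPP : absPP f₀ N ≠ 0 ∨ absPP f₁ N ≠ 0 := by
        by_contra! hcon
        have q0 : ∑ k, absP f₀ k = 0 := by
          by_contra h0; exact absPP_ne_zero h0 N hcon.1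
        have q1 : ∑ k, absP f₁ k = 0 := by
          by_contra h1; exact absPP_ne_zero h1 N hcon.2
        exact hP (by rw [q0, q1, add_zero])
      obtain ⟨c, hc, T, hT, h⟩ := exists_le_norm_of_absPP_ne_zero hmu hlam hne hd hPP
      refine ⟨c / (absM f₀ + (∑ k, absP f₀ k + ∑ k, absP f₁ k) + 1), by positivity, T, hT,
        fun u hu t ht => le_trans ?_ (h u hu t ht)⟩
      rw [hM, zero_mul, add_zero, div_mul_eq_mul_div]
      exact div_le_of_le_mul₀ (by positivity) hc.le
        (mul_le_mul_of_nonneg_left (by linarith) hc.le)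
    · obtain ⟨c, hc, T, hT, h⟩ := exists_sqrt_log_le_norm hmu hlam hne N hd hM
      refine ⟨c / (absM f₀ + absM f₁ + (∑ k, absP f₀ k + ∑ k, absP f₁ k) + 1), by positivity,
        max T 1, by positivity,
        fun u hu t ht => le_trans ?_ (h u hu t ((le_max_left _ _).trans ht))⟩
      -- `log (t + 2) ≥ 1` for `t ≥ 1`, so the bounded terms are absorbed by the growing one
      have hlog : 1 ≤ √(Real.log (t + 2)) := by
        rw [Real.one_le_sqrt, Real.le_log_iff_exp_le (by linarith [(le_max_right T 1).trans ht])]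
        linarith [Real.exp_one_lt_d9, (le_max_right T 1).trans ht]
      set L := √(Real.log (t + 2))
      rw [div_mul_eq_mul_div]
      refine div_le_of_le_mul₀ (by positivity) (by positivity) ?_
      rw [mul_assoc]
      refine mul_le_mul_of_nonneg_left ?_ hc.le
      nlinarith
  · obtain ⟨c, hc, T, hT, h⟩ := exists_le_norm_of_absPP_ne_zero hmu hlam hne hd hP
    have := absM_nonneg f₀
    have := absM_nonneg f₁
    have := absPP_nonneg f₀ N
    have := absPP_nonneg f₁ N
    refine ⟨c / (absM f₀ + absM f₁ + absPP f₀ N + absPP f₁ N + 1), by positivity, T, hT,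
      fun u hu t ht => le_trans ?_ (h u hu t ht)⟩
    rw [div_mul_eq_mul_div]
    exact div_le_of_le_mul₀ (by positivity) hc.le
      (mul_le_mul_of_nonneg_left (by linarith) hc.le)
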